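/- Let $\mathbf{k}$ be a field and let $(\mathbb{I},\le)$ be a directed set (a preordered set in which any two elements have an upper bound; $i<j$ means $i\le j$ and $j\not\le i$). **Conventions.** For a small $\mathbf{k}$-linear category $\mathcal{C}$, let $\operatorname{Mod}\mathcal{C}$ be the category of $\mathbf{k}$-linear functors $\mathcal{C}^{\mathrm{op}}\to\operatorname{Mod}\mathbf{k}$ and $\operatorname{mod}\mathcal{C}$ its full subcategory of finitely presented modules, i.e. modules $M$ with an exact sequence $\mathcal{C}(-,y)\to\mathcal{C}(-,x)\to M\to 0$. A small $\mathbf{k}$-linear category $\mathcal{C}$ is a *dualizing $\mathbf{k}$-variety* if it is Hom-finite and Krull–Schmidt (additive, each object being a finite direct sum of indecomposable objects with local endomorphism rings) and $D=\operatorname{Hom}_{\mathbf{k}}(-,\mathbf{k})$ induces dualities $\operatorname{mod}\mathcal{C}\to\operatorname{mod}(\mathcal{C}^{\mathrm{op}})$ and $\operatorname{mod}(\mathcal{C}^{\mathrm{op}})\to\operatorname{mod}\mathcal{C}$. For a $\mathbf{k}$-linear functor $F:\mathcal{C}\to\mathcal{D}$ put $F_*(M)=M\circ F$; it has the right adjoint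 $F^!(M)(y)=\operatorname{Hom}_{\mathcal{C}}(\mathcal{D}(F(-),y),M)$ and the left adjoint $F^*(M)(y)=M\otimes_{\mathcal{C}}\mathcal{D}(y,F(-))$. $F$ is *coherent preserving* if $F_*$ and $F^!$ preserve finitely presented modules. $F$ is *dense* if it is essentially surjective. **Inverse systems and the firm source.** A *$\mathrm{Cat}$-inverse system* $(\mathcal{C}_i,F_{ij},\theta_{ijk})$ over $\mathbb{I}$ consists of small categories $\mathcal{C}_i$, functors $F_{ij}:\mathcal{C}_j\to\mathcal{C}_i$ for $i<j$ and natural isomorphisms $\theta_{ijk}:F_{ij}F_{jk}\Rightarrow F_{ik}$ for $i<j<k$ with $\theta_{ijl}\circ(F_{ij}\theta_{jkl})=\theta_{ikl}\circ(\theta_{ijk}F_{kl})$ for $i<j<k<l$. Its concrete inverse limit $(\mathcal{C},\Phi_i,\Theta_{ij})$ has as objects the families $x=(x_i,f_{ij})$ with $x_i\in\mathcal{C}_i$ and isomorphisms $f_{ij}:F_{ij}(x_j)\to x_i$ $(i<j)$ such that $f_{ij}\circ F_{ij}(f_{jk})=f_{ik}\circ(\theta_{ijk})_{x_k}$ for $i<j<k$;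 morphisms $(x_i,f_{ij})\to(y_i,g_{ij})$ are families $s_i:x_i\to y_i$ with $s_i\circ f_{ij}=g_{ij}\circ F_{ij}(s_j)$; $\Phi_i(x)=x_i$ and $(\Theta_{ij})_x=f_{ij}:F_{ij}\Phi_j(x)\to\Phi_i(x)$. An object $x$ is *firm* if there is $t\in\mathbb{I}$ such that for all $u>t$ and all $a,b\in\mathcal{C}_u$ the maps $\mathcal{C}_u(\Phi_u(x),b)\to\mathcal{C}_t(F_{tu}\Phi_u(x),F_{tu}(b))$ and $\mathcal{C}_u(a,\Phi_u(x))\to\mathcal{C}_t(F_{tu}(a),F_{tu}\Phi_u(x))$ induced by $F_{tu}$ are bijective. The *firm source* $(\dot{\mathcal{C}},\dot\Phi_i,\dot\Theta_{ij})$ is the full subcategory $\dot{\mathcal{C}}\subseteq\mathcal{C}$ of firm objects with the restrictions of $\Phi_i,\Theta_{ij}$; if the $\mathcal{C}_i$ and $F_{ij}$ are $\mathbf{k}$-linear, it is $\mathbf{k}$-linear with componentwise operations. **Admissible targets.** A *direct system* $(\mathcal{A}_i,G_{ij},\zeta_{ijk})$ consists of categories $\mathcal{A}_i$, functors $G_{ij}:\mathcal{A}_i\to\mathcal{A}_j$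 $(i<j)$ and natural isomorphisms $\zeta_{ijk}:G_{jk}G_{ij}\Rightarrow G_{ik}$ with $\zeta_{ikl}\circ(G_{kl}\zeta_{ijk})=\zeta_{ijl}\circ(\zeta_{jkl}G_{ij})$; a *target* $(\mathcal{A},\Psi_i,Z_{ij})$ of it consists of a category $\mathcal{A}$, functors $\Psi_i:\mathcal{A}_i\to\mathcal{A}$ and natural isomorphisms $Z_{ij}:\Psi_jG_{ij}\Rightarrow\Psi_i$ with $Z_{ik}\circ(\Psi_k\zeta_{ijk})=Z_{ij}\circ(Z_{jk}G_{ij})$. If all $\mathcal{A}_i$ are abelian and all $G_{ij}$ are fully faithful and exact, a target together with adjunctions $(L_i,\Psi_i)$ and $(\Psi_i,R_i)$ is *admissible* if: (i) $\mathcal{A}$ is abelian and all $\Psi_i$ are fully faithful; (ii) for every $x\in\mathcal{A}$ there is $t\in\mathbb{I}$ such that for all $u>t$ the unit of $(L_u,\Psi_u)$ and the counit of $(\Psi_u,R_u)$ are isomorphisms at $x$; (iii) for all $x\in\mathcal{A}$ and $n>0$ there is $t\in\mathbb{I}$ such that for all $u>t$, $z\in\mathcal{A}_u$ and $0<r<n$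 we have $\operatorname{Ext}^r_{\mathcal{A}}(x,\Psi_u(z))\cong\operatorname{Ext}^r_{\mathcal{A}_u}(L_u(x),z)$; (iv) for all $y\in\mathcal{A}$ and $n>0$ there is $t\in\mathbb{I}$ such that for all $u>t$, $z\in\mathcal{A}_u$ and $0<r<n$ we have $\operatorname{Ext}^r_{\mathcal{A}}(\Psi_u(z),y)\cong\operatorname{Ext}^r_{\mathcal{A}_u}(z,R_u(y))$. When the categories are $\mathbf{k}$-linear, the isomorphisms in (iii) and (iv) are meant $\mathbf{k}$-linearly. **Statement.** Let $(\mathcal{C}_i,F_{ij},\theta_{ijk})$ be a $\mathrm{Cat}$-inverse system over $\mathbb{I}$ in which all $\mathcal{C}_i$ are dualizing $\mathbf{k}$-varieties and all $F_{ij}$ are $\mathbf{k}$-linear and coherent preserving. Assume that $\dot{\mathcal{C}}$ is a dualizing $\mathbf{k}$-variety and that all $\dot\Phi_i$ are dense, full and coherent preserving. Then the functors $\dot\Phi_i^*$ restrict to functors $\operatorname{mod}\dot{\mathcal{C}}\to\operatorname{mod}\mathcal{C}_i$; the categories $\operatorname{mod}\mathcal{C}_i$ are abelian and the functors $F_{ij*}:\operatorname{mod}\mathcal{C}_i\to\operatorname{mod}\mathcal{C}_j$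 are fully faithful and exact; and $(\operatorname{mod}\dot{\mathcal{C}},\dot\Phi_{i*},\dot\Theta_{ij*})$, together with the adjunctions $(\dot\Phi_i^*,\dot\Phi_{i*})$ and $(\dot\Phi_{i*},\dot\Phi_i^!)$, is an admissible target of the direct system $(\operatorname{mod}\mathcal{C}_i,F_{ij*},\theta_{ijk*})$. Here $(\theta_{ijk*})_M=M(\theta_{ijk}^{-1}):F_{jk*}F_{ij*}(M)\to F_{ik*}(M)$ and $(\dot\Theta_{ij*})_M=M(\dot\Theta_{ij}^{-1}):\dot\Phi_{j*}F_{ij*}(M)\to\dot\Phi_{i*}(M)$. -/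

import Mathlib

open CategoryTheory CategoryTheory.Limits Opposite

universe u v w v' w' uR

namespace AdmTarget

noncomputable section

/-! ### Modules over a `k`-linear category -/

/-- The `k`-linear structure on the opposite of a `k`-linear category. -/
instance linearOpposite (k : Type uR) [Ring k] (C : Type w) [Category.{v} C] [Preadditive C]
    [Linear k C] : Linear k Cᵒᵖ where
  homModule X Y :=
    { smul := fun r f => (r • f.unop).op
      one_smul := fun f => Quiver.Hom.unop_inj (one_smul k f.unop)
      mul_smul := fun r s f => Quiver.Hom.unop_inj (mul_smul r s f.unop)
      smul_zero := fun r => Quiver.Hom.unop_inj (smul_zero (A := (unop Y ⟶ unop X)) r)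
      smul_add := fun r f g => Quiver.Hom.unop_inj (smul_add r f.unop g.unop)
      add_smul := fun r s f => Quiver.Hom.unop_inj (add_smul r s f.unop)
      zero_smul := fun f => Quiver.Hom.unop_inj (zero_smul k f.unop) }
  smul_comp _ _ _ r f g := Quiver.Hom.unop_inj (Linear.comp_smul _ _ _ g.unop r f.unop)
  comp_smul _ _ _ f r g := Quiver.Hom.unop_inj (Linear.smul_comp _ _ _ r g.unop f.unop)

section Modules

variable (k : Type u) [Field k] (C : Type u) [Category.{u} C] [Preadditive C] [Linear k C]

/-- A functor `Cᵒᵖ ⥤ Mod k` is a right `C`-module if it is `k`-linear. -/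
def isModule : ObjectProperty (Cᵒᵖ ⥤ ModuleCat.{u} k) :=
  fun M => M.Additive ∧ M.Linear k

/-- `Mod C`: the category of right `C`-modules. -/
abbrev ModCat : Type (u + 1) := (isModule k C).FullSubcategory

/-- The Yoneda functor `x ↦ C(-, x)` with values in `Mod C`. -/
def yonedaMod : C ⥤ ModCat k C :=
  (isModule k C).lift (linearYoneda k C) fun _ =>
    ⟨inferInstance, ⟨fun f r => by
      ext g
      exact Linear.smul_comp _ _ _ r f.unop g⟩⟩

/-- `M` is finitely presented: there is an exact sequence `C(-, y) ⟶ C(-, x) ⟶ M ⟶ 0`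
(exactness in `Mod C` is pointwise exactness). -/
def isFP : ObjectProperty (ModCat k C) := fun M =>
  ∃ (x y : C) (f : (yonedaMod k C).obj y ⟶ (yonedaMod k C).obj x) (p : (yonedaMod k C).obj x ⟶ M),
    ∀ c : Cᵒᵖ, Function.Exact (f.hom.app c).hom (p.hom.app c).hom ∧
      Function.Surjective (p.hom.app c).hom

/-- `mod C`: the full subcategory of `Mod C` of finitely presented modules. -/
abbrev FPModCat : Type (u + 1) := (isFP k C).FullSubcategory

end Modules

/-! ### Dualizing varieties -/

section Dualizing

variable (k : Type u) [Field k]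

/-- `D = Hom_k(-, k)` on vector spaces. -/
def vectDual : (ModuleCat.{u} k)ᵒᵖ ⥤ ModuleCat.{u} k where
  obj V := ModuleCat.of k (Module.Dual k V.unop)
  map f := ModuleCat.ofHom f.unop.hom.dualMap

variable (C : Type u) [Category.{u} C] [Preadditive C] [Linear k C]

/-- `D : Mod C ⟶ Mod Cᵒᵖ` (contravariant), `(D M)(x) = Hom_k(M(x), k)`. -/
def modDual : (ModCat k C)ᵒᵖ ⥤ ModCat k Cᵒᵖ where
  obj M := ⟨M.unop.obj.op ⋙ vectDual k, by
    obtain ⟨h1, h2⟩ := M.unop.property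
    refine ⟨⟨fun {X Y f g} => ?_⟩, ⟨fun {X Y} f r => ?_⟩⟩
    · ext φ
      refine LinearMap.ext fun m => ?_
      have h := congrArg (fun q => q.hom m) (M.unop.obj.map_add (f := f.unop) (g := g.unop))
      exact (congrArg (DFunLike.coe (F := Module.Dual k _) φ) h).trans
        (LinearMap.map_add (φ : Module.Dual k _) _ _)
    · ext φ
      refine LinearMap.ext fun m => ?_
      have h := congrArg (fun q => q.hom m) (h2.map_smul f.unop r)
      exact (congrArg (DFunLike.coe (F := Module.Dual k _) φ) h).trans
        (LinearMap.map_smul (φ : Module.Dual k _) _ _)⟩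
  map f := ObjectProperty.homMk (Functor.whiskerRight (NatTrans.op f.unop.hom) (vectDual k))

/-- `D : Mod Cᵒᵖ ⟶ Mod C` (contravariant), `(D N)(x) = Hom_k(N(x), k)`. -/
def modDualOp : (ModCat k Cᵒᵖ)ᵒᵖ ⥤ ModCat k C where
  obj N := ⟨(opOp C).op ⋙ N.unop.obj.op ⋙ vectDual k, by
    obtain ⟨h1, h2⟩ := N.unop.property
    refine ⟨⟨fun {X Y f g} => ?_⟩, ⟨fun {X Y} f r => ?_⟩⟩
    · ext φ
      refine LinearMap.ext fun m => ?_
      have h := congrArg (fun q => q.hom m)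
        (N.unop.obj.map_add (f := f.unop.op.op) (g := g.unop.op.op))
      exact (congrArg (DFunLike.coe (F := Module.Dual k _) φ) h).trans
        (LinearMap.map_add (φ : Module.Dual k _) _ _)
    · ext φ
      refine LinearMap.ext fun m => ?_
      have h := congrArg (fun q => q.hom m) (h2.map_smul f.unop.op.op r)
      exact (congrArg (DFunLike.coe (F := Module.Dual k _) φ) h).trans
        (LinearMap.map_smul (φ : Module.Dual k _) _ _)⟩
  map f := ObjectProperty.homMk (Functor.whiskerLeft (opOp C).op
      (Functor.whiskerRight (NatTrans.op f.unop.hom) (vectDual k)))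

/-- A Krull--Schmidt category: an additive category in which every object is a finite direct sum
of indecomposable objects with local endomorphism rings. -/
structure IsKrullSchmidt (C : Type w) [Category.{v} C] [Preadditive C] : Prop where
  hasFiniteBiproducts : HasFiniteBiproducts C
  exists_decomposition : haveI := hasBinaryBiproducts_of_finite_biproducts C
    ∀ x : C, ∃ (n : ℕ) (y : Fin n → C),
      (∀ a, Indecomposable (y a) ∧ IsLocalRing (End (y a))) ∧ Nonempty (x ≅ ⨁ y)

/-- A dualizing `k`-variety: a Hom-finite `k`-linear Krull--Schmidt category such that the two
functors `D = Hom_k(-, k)` restrict to dualities between `mod C` and `mod Cᵒᵖ`. -/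
structure IsDualizingVariety : Prop where
  homFinite : ∀ x y : C, Module.Finite k (x ⟶ y)
  krullSchmidt : IsKrullSchmidt C
  dual_mem : ∀ M : FPModCat k C, isFP k Cᵒᵖ ((modDual k C).obj (op M.obj))
  dualOp_mem : ∀ N : FPModCat k Cᵒᵖ, isFP k C ((modDualOp k C).obj (op N.obj))
  isEquivalence_dual :
    ((isFP k Cᵒᵖ).lift ((isFP k C).ι.op ⋙ modDual k C) fun M => dual_mem M.unop).IsEquivalence
  isEquivalence_dualOp :
    ((isFP k C).lift ((isFP k Cᵒᵖ).ι.op ⋙ modDualOp k C) fun N => dualOp_mem N.unop).IsEquivalence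

end Dualizing

/-! ### Tensor products of modules over a category -/

section Tensor

open TensorProduct Classical

variable {k : Type u} [Field k] {C : Type u} [Category.{u} C]

/-- The relations `(m · f) ⊗ n = m ⊗ (f · n)` defining the tensor product over `C`. -/
def tensorRel (M : Cᵒᵖ ⥤ ModuleCat.{u} k) (N : C ⥤ ModuleCat.{u} k) :
    Submodule k (DirectSum C fun x => M.obj (op x) ⊗[k] N.obj x) :=
  Submodule.span k {z | ∃ (x y : C) (f : x ⟶ y) (m : M.obj (op y)) (n : N.obj x),
    z = DirectSum.lof k C (fun x => M.obj (op x) ⊗[k] N.obj x) x ((M.map f.op).hom m ⊗ₜ n) -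
      DirectSum.lof k C (fun x => M.obj (op x) ⊗[k] N.obj x) y (m ⊗ₜ (N.map f).hom n)}

/-- The tensor product `M ⊗_C N` of a right module `M` and a left module `N`. -/
abbrev TensorOver (M : Cᵒᵖ ⥤ ModuleCat.{u} k) (N : C ⥤ ModuleCat.{u} k) : Type u :=
  (DirectSum C fun x => M.obj (op x) ⊗[k] N.obj x) ⧸ tensorRel M N

/-- The canonical bilinear map `M(x) × N(x) → M ⊗_C N`. -/
def tmulOver (M : Cᵒᵖ ⥤ ModuleCat.{u} k) (N : C ⥤ ModuleCat.{u} k) (x : C) :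
    M.obj (op x) →ₗ[k] N.obj x →ₗ[k] TensorOver M N :=
  (TensorProduct.mk k (M.obj (op x)) (N.obj x)).compr₂
    ((tensorRel M N).mkQ ∘ₗ DirectSum.lof k C (fun x => M.obj (op x) ⊗[k] N.obj x) x)

lemma tmulOver_balanced (M : Cᵒᵖ ⥤ ModuleCat.{u} k) (N : C ⥤ ModuleCat.{u} k) {x y : C} (f : x ⟶ y)
    (m : M.obj (op y)) (n : N.obj x) :
    tmulOver M N x ((M.map f.op).hom m) n = tmulOver M N y m ((N.map f).hom n) :=
  (Submodule.Quotient.eq _).2 (Submodule.subset_span ⟨x, y, f, m, n, rfl⟩)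

/-- A family of bilinear maps that respects the relations induces a map on the tensor product. -/
def tensorLift {M : Cᵒᵖ ⥤ ModuleCat.{u} k} {N : C ⥤ ModuleCat.{u} k} {P : Type u} [AddCommGroup P]
    [Module k P] (φ : ∀ x, M.obj (op x) →ₗ[k] N.obj x →ₗ[k] P)
    (h : ∀ (x y : C) (f : x ⟶ y) (m : M.obj (op y)) (n : N.obj x),
      φ x ((M.map f.op).hom m) n = φ y m ((N.map f).hom n)) :
    TensorOver M N →ₗ[k] P :=
  (tensorRel M N).liftQ (DirectSum.toModule k C P fun x => TensorProduct.lift (φ x)) (by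
    refine Submodule.span_le.2 ?_
    rintro z ⟨x, y, f, m, n, rfl⟩
    simp [h])

@[simp]
lemma tensorLift_tmulOver {M : Cᵒᵖ ⥤ ModuleCat.{u} k} {N : C ⥤ ModuleCat.{u} k} {P : Type u}
    [AddCommGroup P] [Module k P] (φ : ∀ x, M.obj (op x) →ₗ[k] N.obj x →ₗ[k] P) (h) (x : C)
    (m : M.obj (op x)) (n : N.obj x) : tensorLift φ h (tmulOver M N x m n) = φ x m n := by
  change DirectSum.toModule k C P (fun x => TensorProduct.lift (φ x))
    (DirectSum.lof k C (fun x => M.obj (op x) ⊗[k] N.obj x) x (m ⊗ₜ n)) = _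
  simp

lemma tensor_hom_ext {M : Cᵒᵖ ⥤ ModuleCat.{u} k} {N : C ⥤ ModuleCat.{u} k} {P : Type u}
    [AddCommGroup P] [Module k P] {φ ψ : TensorOver M N →ₗ[k] P}
    (h : ∀ x m n, φ (tmulOver M N x m n) = ψ (tmulOver M N x m n)) : φ = ψ := by
  refine Submodule.linearMap_qext _ (DirectSum.linearMap_ext k fun x => ?_)
  exact TensorProduct.ext' fun m n => h x m n

/-- Functoriality of `M ⊗_C N` in `N`. -/
def tensorMapRight (M : Cᵒᵖ ⥤ ModuleCat.{u} k) {N N' : C ⥤ ModuleCat.{u} k} (β : N ⟶ N') :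
    TensorOver M N →ₗ[k] TensorOver M N' :=
  tensorLift (fun x => (tmulOver M N' x).compl₂ (β.app x).hom) (fun x y f m n => by
    have := congrArg (fun q => q.hom n) (β.naturality f)
    simp only [ModuleCat.hom_comp, LinearMap.comp_apply] at this
    simp [tmulOver_balanced, this])

@[simp]
lemma tensorMapRight_tmulOver (M : Cᵒᵖ ⥤ ModuleCat.{u} k) {N N' : C ⥤ ModuleCat.{u} k}
    (β : N ⟶ N') (x : C) (m : M.obj (op x)) (n : N.obj x) :
    tensorMapRight M β (tmulOver M N x m n) = tmulOver M N' x m ((β.app x).hom n) :=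
  tensorLift_tmulOver _ _ x m n

/-- Functoriality of `M ⊗_C N` in `M`. -/
def tensorMapLeft {M M' : Cᵒᵖ ⥤ ModuleCat.{u} k} (α : M ⟶ M') (N : C ⥤ ModuleCat.{u} k) :
    TensorOver M N →ₗ[k] TensorOver M' N :=
  tensorLift (fun x => (tmulOver M' N x) ∘ₗ (α.app (op x)).hom) (fun x y f m n => by
    have := congrArg (fun q => q.hom m) (α.naturality f.op)
    simp only [ModuleCat.hom_comp, LinearMap.comp_apply] at this
    simp [← tmulOver_balanced, this])

@[simp]
lemma tensorMapLeft_tmulOver {M M' : Cᵒᵖ ⥤ ModuleCat.{u} k} (α : M ⟶ M')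
    (N : C ⥤ ModuleCat.{u} k) (x : C) (m : M.obj (op x)) (n : N.obj x) :
    tensorMapLeft α N (tmulOver M N x m n) = tmulOver M' N x ((α.app (op x)).hom m) n :=
  tensorLift_tmulOver _ _ x m n

lemma tensorMapRight_id (M : Cᵒᵖ ⥤ ModuleCat.{u} k) (N : C ⥤ ModuleCat.{u} k) :
    tensorMapRight M (𝟙 N) = LinearMap.id :=
  tensor_hom_ext fun x m n => by simp

lemma tensorMapRight_comp (M : Cᵒᵖ ⥤ ModuleCat.{u} k) {N N' N'' : C ⥤ ModuleCat.{u} k}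
    (β : N ⟶ N') (γ : N' ⟶ N'') :
    tensorMapRight M (β ≫ γ) = tensorMapRight M γ ∘ₗ tensorMapRight M β :=
  tensor_hom_ext fun x m n => by
    rw [LinearMap.comp_apply]
    simp

lemma tensorMap_comm {M M' : Cᵒᵖ ⥤ ModuleCat.{u} k} (α : M ⟶ M') {N N' : C ⥤ ModuleCat.{u} k}
    (β : N ⟶ N') :
    tensorMapLeft α N' ∘ₗ tensorMapRight M β = tensorMapRight M' β ∘ₗ tensorMapLeft α N :=
  tensor_hom_ext fun x m n => by
    rw [LinearMap.comp_apply, LinearMap.comp_apply]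
    simp

end Tensor

/-! ### The functors `F_*`, `F^!`, `F^*` between module categories -/

section Induced

variable (k : Type u) [Field k] {C D : Type u} [Category.{u} C]
  [Category.{u} D] [Preadditive D] [Linear k D] (F : C ⥤ D)

/-- The functor `y ↦ M ⊗_C D(y, F(-))`. -/
def indObj (M : Cᵒᵖ ⥤ ModuleCat.{u} k) : Dᵒᵖ ⥤ ModuleCat.{u} k where
  obj Y := ModuleCat.of k (TensorOver M (F ⋙ (linearCoyoneda k D).obj Y))
  map h := ModuleCat.ofHom (tensorMapRight M (Functor.whiskerLeft F ((linearCoyoneda k D).map h)))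
  map_id Y := ModuleCat.hom_ext (by
    rw [CategoryTheory.Functor.map_id, Functor.whiskerLeft_id', tensorMapRight_id]
    rfl)
  map_comp g h := ModuleCat.hom_ext (by
    rw [Functor.map_comp, Functor.whiskerLeft_comp, tensorMapRight_comp]
    rfl)

/-- The element `m ⊗ g` of `F^*(M)(y)`, for `m ∈ M(x)` and `g : y ⟶ F(x)`. -/
def indMk (M : Cᵒᵖ ⥤ ModuleCat.{u} k) (x : C) (y : D) :
    M.obj (op x) →ₗ[k] (y ⟶ F.obj x) →ₗ[k] (indObj k F M).obj (op y) :=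
  tmulOver M (F ⋙ (linearCoyoneda k D).obj (op y)) x

lemma indMk_balanced (M : Cᵒᵖ ⥤ ModuleCat.{u} k) {x x' : C} (f : x ⟶ x') (y : D)
    (m : M.obj (op x')) (g : y ⟶ F.obj x) :
    indMk k F M x y ((M.map f.op).hom m) g = indMk k F M x' y m (g ≫ F.map f) :=
  tmulOver_balanced M (F ⋙ (linearCoyoneda k D).obj (op y)) f m g

lemma indObj_map_indMk (M : Cᵒᵖ ⥤ ModuleCat.{u} k) (x : C) {y y' : D} (h : y' ⟶ y)
    (m : M.obj (op x)) (g : y ⟶ F.obj x) :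
    ((indObj k F M).map h.op).hom (indMk k F M x y m g) = indMk k F M x y' m (h ≫ g) :=
  tensorMapRight_tmulOver M (Functor.whiskerLeft F ((linearCoyoneda k D).map h.op)) x m g

lemma indObj_hom_ext {M : Cᵒᵖ ⥤ ModuleCat.{u} k} {y : D} {P : ModuleCat.{u} k}
    {φ ψ : (indObj k F M).obj (op y) ⟶ P}
    (h : ∀ x m g, φ.hom (indMk k F M x y m g) = ψ.hom (indMk k F M x y m g)) : φ = ψ :=
  ModuleCat.hom_ext (tensor_hom_ext h)

lemma indObj_isModule (M : Cᵒᵖ ⥤ ModuleCat.{u} k) : isModule k D (indObj k F M) := by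
  refine ⟨⟨fun {X Y f g} => ?_⟩, ⟨fun {X Y} f r => ?_⟩⟩
  · refine indObj_hom_ext k F fun x m n => ?_
    rw [ModuleCat.hom_add, LinearMap.add_apply]
    refine (indObj_map_indMk k F M x (f + g).unop m n).trans ?_
    refine Eq.trans ?_ (congrArg₂ (· + ·) (indObj_map_indMk k F M x f.unop m n)
      (indObj_map_indMk k F M x g.unop m n)).symm
    rw [unop_add, Preadditive.add_comp, map_add]
  · refine indObj_hom_ext k F fun x m n => ?_
    rw [ModuleCat.hom_smul, LinearMap.smul_apply]
    refine (indObj_map_indMk k F M x (r • f.unop) m n).trans ?_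
    refine Eq.trans ?_ (congrArg (r • ·) (indObj_map_indMk k F M x f.unop m n)).symm
    rw [Linear.smul_comp, map_smul]

/-- The map `F^*(M)(y) ⟶ F^*(M')(y)` induced by `α : M ⟶ M'`. -/
def indMap {M M' : Cᵒᵖ ⥤ ModuleCat.{u} k} (α : M ⟶ M') : indObj k F M ⟶ indObj k F M' where
  app Y := ModuleCat.ofHom (tensorMapLeft α (F ⋙ (linearCoyoneda k D).obj Y))
  naturality _ _ f := ModuleCat.hom_ext
    (tensorMap_comm α (Functor.whiskerLeft F ((linearCoyoneda k D).map f)))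

lemma indMap_indMk {M M' : Cᵒᵖ ⥤ ModuleCat.{u} k} (α : M ⟶ M') (x : C) (y : D)
    (m : M.obj (op x)) (g : y ⟶ F.obj x) :
    ((indMap k F α).app (op y)).hom (indMk k F M x y m g) =
      indMk k F M' x y ((α.app (op x)).hom m) g :=
  tensorMapLeft_tmulOver α (F ⋙ (linearCoyoneda k D).obj (op y)) x m g

/-- The bilinear map `(m, g) ↦ N(g)(ψ(m))` given by `ψ : M ⟶ N ∘ F`. -/
def indBilin {M : Cᵒᵖ ⥤ ModuleCat.{u} k} {N : Dᵒᵖ ⥤ ModuleCat.{u} k} (hN : isModule k D N)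
    (ψ : M ⟶ F.op ⋙ N) (x : C) (y : D) :
    M.obj (op x) →ₗ[k] (y ⟶ F.obj x) →ₗ[k] N.obj (op y) :=
  LinearMap.mk₂ k
    (fun m g => (N.map g.op).hom ((ψ.app (op x)).hom m))
    (fun m m' g => by
      rw [map_add]
      exact map_add _ _ _)
    (fun r m g => by
      rw [map_smul]
      exact map_smul _ _ _)
    (fun m g g' => by
      have := hN.1
      exact congrArg (fun q => q.hom ((ψ.app (op x)).hom m))
        (N.map_add (f := g.op) (g := g'.op)))
    (fun r m g => congrArg (fun q => q.hom ((ψ.app (op x)).hom m)) (hN.2.map_smul g.op r))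

lemma indBilin_balanced {M : Cᵒᵖ ⥤ ModuleCat.{u} k} {N : Dᵒᵖ ⥤ ModuleCat.{u} k}
    (hN : isModule k D N) (ψ : M ⟶ F.op ⋙ N) {x x' : C} (f : x ⟶ x') (y : D)
    (m : M.obj (op x')) (g : y ⟶ F.obj x) :
    indBilin k F hN ψ x y ((M.map f.op).hom m) g = indBilin k F hN ψ x' y m (g ≫ F.map f) := by
  have h1 := congrArg (fun q => q.hom m) (ψ.naturality f.op)
  have h2 := congrArg (fun q => q.hom ((ψ.app (op x')).hom m))
    (N.map_comp (F.map f).op g.op)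
  exact (congrArg (N.map g.op).hom h1).trans h2.symm

/-- The linear map `F^*(M)(y) → N(y)`, `m ⊗ g ↦ N(g)(ψ(m))`, given by `ψ : M ⟶ N ∘ F`. -/
def indLiftApp {M : Cᵒᵖ ⥤ ModuleCat.{u} k} {N : Dᵒᵖ ⥤ ModuleCat.{u} k} (hN : isModule k D N)
    (ψ : M ⟶ F.op ⋙ N) (y : D) : (indObj k F M).obj (op y) →ₗ[k] N.obj (op y) :=
  tensorLift (M := M) (N := F ⋙ (linearCoyoneda k D).obj (op y))
    (fun x => indBilin k F hN ψ x y) (fun _ _ f m g => indBilin_balanced k F hN ψ f y m g)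

lemma indLiftApp_indMk {M : Cᵒᵖ ⥤ ModuleCat.{u} k} {N : Dᵒᵖ ⥤ ModuleCat.{u} k}
    (hN : isModule k D N) (ψ : M ⟶ F.op ⋙ N) (x : C) (y : D) (m : M.obj (op x))
    (g : y ⟶ F.obj x) :
    indLiftApp k F hN ψ y (indMk k F M x y m g) = (N.map g.op).hom ((ψ.app (op x)).hom m) :=
  tensorLift_tmulOver (M := M) (N := F ⋙ (linearCoyoneda k D).obj (op y))
    (fun x => indBilin k F hN ψ x y) (fun _ _ f m g => indBilin_balanced k F hN ψ f y m g) x m g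

/-- The natural transformation `F^*(M) ⟶ N` corresponding to `ψ : M ⟶ N ∘ F`. -/
def indLift {M : Cᵒᵖ ⥤ ModuleCat.{u} k} {N : Dᵒᵖ ⥤ ModuleCat.{u} k} (hN : isModule k D N)
    (ψ : M ⟶ F.op ⋙ N) : indObj k F M ⟶ N where
  app Y := ModuleCat.ofHom (indLiftApp k F hN ψ Y.unop)
  naturality X Y f := indObj_hom_ext k F fun x m g => by
    have h1 := indObj_map_indMk k F M x f.unop m g
    have h2 := congrArg (fun q => q.hom ((ψ.app (op x)).hom m)) (N.map_comp g.op f)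
    exact ((congrArg (indLiftApp k F hN ψ Y.unop) h1).trans
      (indLiftApp_indMk k F hN ψ x Y.unop m _)).trans (h2.trans
        (congrArg (N.map f).hom (indLiftApp_indMk k F hN ψ x X.unop m g).symm))

lemma indLift_indMk {M : Cᵒᵖ ⥤ ModuleCat.{u} k} {N : Dᵒᵖ ⥤ ModuleCat.{u} k} (hN : isModule k D N)
    (ψ : M ⟶ F.op ⋙ N) (x : C) (y : D) (m : M.obj (op x)) (g : y ⟶ F.obj x) :
    ((indLift k F hN ψ).app (op y)).hom (indMk k F M x y m g) =
      (N.map g.op).hom ((ψ.app (op x)).hom m) :=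
  indLiftApp_indMk k F hN ψ x y m g

/-- The natural transformation `M ⟶ N ∘ F`, `m ↦ φ(m ⊗ 1)`, corresponding to `φ : F^*(M) ⟶ N`. -/
def indUnlift {M : Cᵒᵖ ⥤ ModuleCat.{u} k} {N : Dᵒᵖ ⥤ ModuleCat.{u} k} (φ : indObj k F M ⟶ N) :
    M ⟶ F.op ⋙ N where
  app X := ModuleCat.ofHom ((φ.app (op (F.obj X.unop))).hom ∘ₗ
    (indMk k F M X.unop (F.obj X.unop)).flip (𝟙 _))
  naturality X Y f := by
    ext m
    have h1 := indMk_balanced k F M f.unop (F.obj Y.unop) m (𝟙 _)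
    have h2 := indObj_map_indMk k F M X.unop (F.map f.unop) m (𝟙 _)
    have h3 := congrArg (fun q => q.hom (indMk k F M X.unop (F.obj X.unop) m (𝟙 _)))
      (φ.naturality (F.map f.unop).op)
    rw [Category.id_comp] at h1
    rw [Category.comp_id] at h2
    exact (congrArg (φ.app (op (F.obj Y.unop))).hom (h1.trans h2.symm)).trans h3

lemma indLift_indUnlift {M : Cᵒᵖ ⥤ ModuleCat.{u} k} {N : Dᵒᵖ ⥤ ModuleCat.{u} k}
    (hN : isModule k D N) (φ : indObj k F M ⟶ N) : indLift k F hN (indUnlift k F φ) = φ :=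
  NatTrans.ext (funext fun Y => indObj_hom_ext k F fun x m g => by
    have h2 := indObj_map_indMk k F M x g m (𝟙 _)
    rw [Category.comp_id] at h2
    have h3 := congrArg (fun q => q.hom (indMk k F M x (F.obj x) m (𝟙 _)))
      (φ.naturality g.op)
    exact (indLift_indMk k F hN _ x Y.unop m g).trans
      (h3.symm.trans (congrArg (φ.app Y).hom h2)))

lemma indUnlift_indLift {M : Cᵒᵖ ⥤ ModuleCat.{u} k} {N : Dᵒᵖ ⥤ ModuleCat.{u} k}
    (hN : isModule k D N) (ψ : M ⟶ F.op ⋙ N) : indUnlift k F (indLift k F hN ψ) = ψ := by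
  ext X m
  refine (indLift_indMk k F hN ψ X.unop _ m (𝟙 _)).trans ?_
  exact congrArg (fun q => q.hom ((ψ.app X).hom m)) (N.map_id _)

variable [Preadditive C] [Linear k C]

/-- `F^* : Mod C ⥤ Mod D`, `F^*(M)(y) = M ⊗_C D(y, F(-))`. -/
def ind : ModCat k C ⥤ ModCat k D where
  obj M := ⟨indObj k F M.obj, indObj_isModule k F M.obj⟩
  map α := ObjectProperty.homMk (indMap k F α.hom)
  map_id _ := ObjectProperty.hom_ext _ (NatTrans.ext (funext fun Y =>
    indObj_hom_ext k F fun x m g => (indMap_indMk k F _ x Y.unop m g).trans rfl))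
  map_comp α β := ObjectProperty.hom_ext _ (NatTrans.ext (funext fun Y =>
    indObj_hom_ext k F fun x m g => (indMap_indMk k F _ x Y.unop m g).trans
      ((congrArg ((indMap k F β.hom).app Y).hom (indMap_indMk k F α.hom x Y.unop m g)).trans
        (indMap_indMk k F β.hom x Y.unop _ g)).symm))

variable [F.Additive] [F.Linear k]

/-- `F_* : Mod D ⥤ Mod C`, `M ↦ M ∘ F`. -/
def restr : ModCat k D ⥤ ModCat k C where
  obj M := ⟨F.op ⋙ M.obj, by
    obtain ⟨h1, h2⟩ := M.property
    refine ⟨inferInstance, ⟨fun f r => ?_⟩⟩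
    exact (congrArg (fun q => M.obj.map q.op) (F.map_smul r f.unop)).trans
      (h2.map_smul (F.map f.unop).op r)⟩
  map f := ObjectProperty.homMk (Functor.whiskerLeft F.op f.hom)

/-- `F^! : Mod C ⥤ Mod D`, `F^!(M)(y) = Hom_C(D(F(-), y), M)`. -/
def coind : ModCat k C ⥤ ModCat k D :=
  (isModule k D).lift
    (linearYoneda k (ModCat k C) ⋙
      (Functor.whiskeringLeft _ _ _).obj (yonedaMod k D ⋙ restr k F).op) fun M => by
    refine ⟨⟨fun {X Y f g} => ?_⟩, ⟨fun {X Y} f r => ?_⟩⟩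
    · ext (φ : (restr k F).obj ((yonedaMod k D).obj X.unop) ⟶ M)
      refine ObjectProperty.hom_ext _ ?_
      ext Z (h : F.obj Z.unop ⟶ Y.unop)
      refine (congrArg (φ.hom.app Z).hom (Preadditive.comp_add _ _ _ h f.unop g.unop)).trans ?_
      exact map_add _ _ _
    · ext (φ : (restr k F).obj ((yonedaMod k D).obj X.unop) ⟶ M)
      refine ObjectProperty.hom_ext _ ?_
      ext Z (h : F.obj Z.unop ⟶ Y.unop)
      refine (congrArg (φ.hom.app Z).hom (Linear.comp_smul _ _ _ h r f.unop)).trans ?_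
      exact map_smul _ _ _

/-- The adjunction `(F^*, F_*)`: a map `φ : F^*(M) ⟶ N` corresponds to `m ↦ φ(m ⊗ 1)`. -/
def indAdj : ind k F ⊣ restr k F :=
  Adjunction.mkOfHomEquiv
    { homEquiv := fun _ N =>
        { toFun := fun φ => ObjectProperty.homMk (indUnlift k F φ.hom)
          invFun := fun ψ => ObjectProperty.homMk (indLift k F N.property ψ.hom)
          left_inv := fun φ => ObjectProperty.hom_ext _ (indLift_indUnlift k F N.property φ.hom)
          right_inv := fun ψ => ObjectProperty.hom_ext _ (indUnlift_indLift k F N.property ψ.hom) }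
      homEquiv_naturality_left_symm := fun {_ _ N} α ψ =>
        ObjectProperty.hom_ext _ (NatTrans.ext (funext fun Y =>
          indObj_hom_ext k F fun x m g =>
            (indLift_indMk k F N.property (α.hom ≫ ψ.hom) x Y.unop m g).trans
              ((congrArg ((indLift k F N.property ψ.hom).app Y).hom
                (indMap_indMk k F α.hom x Y.unop m g)).trans
                (indLift_indMk k F N.property ψ.hom x Y.unop _ g)).symm))
      homEquiv_naturality_right := fun _ _ => rfl }

/-- The map `C(-, y) ⟶ N`, `g ↦ N(g)(n)`, given by `n ∈ N(y)`. -/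
def yonedaHom (N : ModCat k D) (y : D) : N.obj.obj (op y) →ₗ[k] ((yonedaMod k D).obj y ⟶ N) where
  toFun n := ObjectProperty.homMk
    { app := fun X => ModuleCat.ofHom
        (X := (X.unop ⟶ y))
        { toFun := fun g => (N.obj.map g.op).hom n
          map_add' := fun g g' => by
            have := N.property.1
            exact congrArg (fun q => q.hom n) (N.obj.map_add (f := g.op) (g := g'.op))
          map_smul' := fun r g => congrArg (fun q => q.hom n) (N.property.2.map_smul g.op r) }
      naturality := fun X Y f => by
        ext (g : X.unop ⟶ y)
        exact congrArg (fun q => q.hom n) (N.obj.map_comp g.op f) }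
  map_add' n n' := ObjectProperty.hom_ext _ (NatTrans.ext (funext fun X => by
    ext (g : X.unop ⟶ y)
    exact map_add (N.obj.map g.op).hom n n'))
  map_smul' r n := ObjectProperty.hom_ext _ (NatTrans.ext (funext fun X => by
    ext (g : X.unop ⟶ y)
    exact map_smul (N.obj.map g.op).hom r n))

lemma yonedaHom_map (N : ModCat k D) {y y' : D} (h : y' ⟶ y) (n : N.obj.obj (op y)) :
    yonedaHom k N y' ((N.obj.map h.op).hom n) = (yonedaMod k D).map h ≫ yonedaHom k N y n :=
  ObjectProperty.hom_ext _ (NatTrans.ext (funext fun X => by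
    ext (g : X.unop ⟶ y')
    exact congrArg (fun q => q.hom n) (N.obj.map_comp h.op g.op).symm))

/-- The value `α(1) ∈ M(x)` of a map `α : D(F(-), F(x)) ⟶ M`. -/
def coindEval (M : ModCat k C) (x : C) :
    ((restr k F).obj ((yonedaMod k D).obj (F.obj x)) ⟶ M) →ₗ[k] M.obj.obj (op x) where
  toFun α := (α.hom.app (op x)).hom (show F.obj x ⟶ F.obj x from 𝟙 _)
  map_add' _ _ := rfl
  map_smul' _ _ := rfl

/-- The map `F_*(N) ⟶ M` corresponding to `ψ : N ⟶ F^!(M)`. -/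
def coindUnlift {N : ModCat k D} {M : ModCat k C} (ψ : N ⟶ (coind k F).obj M) :
    (restr k F).obj N ⟶ M :=
  ObjectProperty.homMk
    { app := fun X => ModuleCat.ofHom
        (coindEval k F M X.unop ∘ₗ (ψ.hom.app (op (F.obj X.unop))).hom)
      naturality := fun X Y f => by
        ext (n : N.obj.obj (op (F.obj X.unop)))
        have h1 := congrArg (fun q => coindEval k F M Y.unop (q.hom n))
          (ψ.hom.naturality (F.map f.unop).op)
        let α : (restr k F).obj ((yonedaMod k D).obj (F.obj X.unop)) ⟶ M :=
          (ψ.hom.app (op (F.obj X.unop))).hom n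
        have h2 := congrArg (fun q => q.hom (show F.obj X.unop ⟶ F.obj X.unop from 𝟙 _))
          (α.hom.naturality f)
        refine h1.trans (Eq.trans ?_ h2)
        refine congrArg (α.hom.app Y).hom ?_
        exact (Category.id_comp (F.map f.unop)).trans (Category.comp_id (F.map f.unop)).symm }

/-- The map `N ⟶ F^!(M)` corresponding to `φ : F_*(N) ⟶ M`. -/
def coindLift {N : ModCat k D} {M : ModCat k C} (φ : (restr k F).obj N ⟶ M) :
    N ⟶ (coind k F).obj M :=
  ObjectProperty.homMk
    { app := fun Y => ModuleCat.ofHom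
        (Y := ((restr k F).obj ((yonedaMod k D).obj Y.unop) ⟶ M))
        { toFun := fun n => (restr k F).map (yonedaHom k N Y.unop n) ≫ φ
          map_add' := fun n n' => by
            rw [map_add]
            exact Preadditive.add_comp _ _ _ ((restr k F).map (yonedaHom k N Y.unop n))
              ((restr k F).map (yonedaHom k N Y.unop n')) φ
          map_smul' := fun r n => by
            rw [map_smul]
            exact Linear.smul_comp _ _ _ r ((restr k F).map (yonedaHom k N Y.unop n)) φ }
      naturality := fun Y Y' f => by
        ext n
        exact (congrArg (fun q => (restr k F).map q ≫ φ) (yonedaHom_map k N f.unop n)) }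

lemma coindUnlift_coindLift {N : ModCat k D} {M : ModCat k C} (φ : (restr k F).obj N ⟶ M) :
    coindUnlift k F (coindLift k F φ) = φ :=
  ObjectProperty.hom_ext _ (NatTrans.ext (funext fun X => by
    ext (n : N.obj.obj (op (F.obj X.unop)))
    exact congrArg (fun q => (φ.hom.app X).hom (q.hom n)) (N.obj.map_id _)))

lemma coindLift_coindUnlift {N : ModCat k D} {M : ModCat k C} (ψ : N ⟶ (coind k F).obj M) :
    coindLift k F (coindUnlift k F ψ) = ψ :=
  ObjectProperty.hom_ext _ (NatTrans.ext (funext fun Y => by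
    ext (n : N.obj.obj (op Y.unop))
    refine ObjectProperty.hom_ext _ (NatTrans.ext (funext fun X => ?_))
    ext (g : F.obj X.unop ⟶ Y.unop)
    let α : (restr k F).obj ((yonedaMod k D).obj Y.unop) ⟶ M := (ψ.hom.app Y).hom n
    refine (congrArg (fun q => coindEval k F M X.unop (q.hom n)) (ψ.hom.naturality g.op)).trans ?_
    exact congrArg (α.hom.app X).hom (Category.id_comp g)))

/-- The adjunction `(F_*, F^!)`: a map `φ : F_*(N) ⟶ M` corresponds to the map sending `n ∈ N(y)` to
`D(F(-), y) ⟶ M`, `g ↦ φ(N(g)(n))`. -/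
def coindAdj : restr k F ⊣ coind k F :=
  Adjunction.mkOfHomEquiv
    { homEquiv := fun _ _ =>
        { toFun := coindLift k F
          invFun := coindUnlift k F
          left_inv := coindUnlift_coindLift k F
          right_inv := coindLift_coindUnlift k F }
      homEquiv_naturality_left_symm := fun _ _ => rfl
      homEquiv_naturality_right := fun _ _ => rfl }

/-- `F` is coherent preserving: `F_*` and `F^!` preserve finitely presented modules. -/
structure IsCoherentPreserving : Prop where
  restr_mem : ∀ M : FPModCat k D, isFP k C ((restr k F).obj M.obj)
  coind_mem : ∀ M : FPModCat k C, isFP k D ((coind k F).obj M.obj)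

/-- The restriction `F_* : mod D ⥤ mod C` for a coherent preserving functor `F`. -/
def fpRestr {F : C ⥤ D} [F.Additive] [F.Linear k] (h : IsCoherentPreserving k F) :
    FPModCat k D ⥤ FPModCat k C :=
  (isFP k C).lift ((isFP k D).ι ⋙ restr k F) h.restr_mem

/-- The restriction `F^! : mod C ⥤ mod D` for a coherent preserving functor `F`. -/
def fpCoind {F : C ⥤ D} [F.Additive] [F.Linear k] (h : IsCoherentPreserving k F) :
    FPModCat k C ⥤ FPModCat k D :=
  (isFP k D).lift ((isFP k C).ι ⋙ coind k F) h.coind_mem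

/-- The restriction `F^* : mod C ⥤ mod D`. -/
def fpInd {F : C ⥤ D} (h : ∀ M : FPModCat k C, isFP k D ((ind k F).obj M.obj)) :
    FPModCat k C ⥤ FPModCat k D :=
  (isFP k D).lift ((isFP k C).ι ⋙ ind k F) h

/-- The adjunction `(F^*, F_*)` restricted to finitely presented modules. -/
def fpIndAdj {F : C ⥤ D} [F.Additive] [F.Linear k]
    (h : ∀ M : FPModCat k C, isFP k D ((ind k F).obj M.obj)) (h' : IsCoherentPreserving k F) :
    fpInd k h ⊣ fpRestr k h' :=
  (indAdj k F).restrictFullyFaithful (isFP k C).fullyFaithfulι (isFP k D).fullyFaithfulι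
    (Iso.refl _) (Iso.refl _)

/-- The adjunction `(F_*, F^!)` restricted to finitely presented modules. -/
def fpCoindAdj {F : C ⥤ D} [F.Additive] [F.Linear k] (h : IsCoherentPreserving k F) :
    fpRestr k h ⊣ fpCoind k h :=
  (coindAdj k F).restrictFullyFaithful (isFP k D).fullyFaithfulι (isFP k C).fullyFaithfulι
    (Iso.refl _) (Iso.refl _)

end Induced

/-! ### Inverse systems of categories, sources, the concrete inverse limit and the firm source -/

/-- An inverse system of categories `(C_i, F_ij, θ_ijk)` over `I`. -/
structure InverseSystem (I : Type u) [Preorder I] (C : I → Type w) [∀ i, Category.{v} (C i)] where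
  F : ∀ {i j : I}, i < j → (C j ⥤ C i)
  θ : ∀ {i j k : I} (hij : i < j) (hjk : j < k), F hjk ⋙ F hij ≅ F (hij.trans hjk)
  comm : ∀ {i j k l : I} (hij : i < j) (hjk : j < k) (hkl : k < l) (x : C l),
    (F hij).map ((θ hjk hkl).hom.app x) ≫ (θ hij (hjk.trans hkl)).hom.app x =
      (θ hij hjk).hom.app ((F hkl).obj x) ≫ (θ (hij.trans hjk) hkl).hom.app x

namespace InverseSystem

variable {I : Type u} [Preorder I] {C : I → Type w} [∀ i, Category.{v} (C i)]

/-- A source `(E, Φ_i, Θ_ij)` of an inverse system. -/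
structure Source (S : InverseSystem I C) (E : Type w') [Category.{v'} E] where
  Φ : ∀ i, E ⥤ C i
  Θ : ∀ {i j : I} (h : i < j), Φ j ⋙ S.F h ≅ Φ i
  comm : ∀ {i j k : I} (hij : i < j) (hjk : j < k) (x : E),
    (S.F hij).map ((Θ hjk).hom.app x) ≫ (Θ hij).hom.app x =
      (S.θ hij hjk).hom.app ((Φ k).obj x) ≫ (Θ (hij.trans hjk)).hom.app x

lemma comm_inv (S : InverseSystem I C) {i j k l : I} (hij : i < j) (hjk : j < k) (hkl : k < l)
    (x : C l) :
    (S.θ (hij.trans hjk) hkl).inv.app x ≫ (S.θ hij hjk).inv.app ((S.F hkl).obj x) =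
      (S.θ hij (hjk.trans hkl)).inv.app x ≫ (S.F hij).map ((S.θ hjk hkl).inv.app x) := by
  have h := S.comm hij hjk hkl x
  rw [← cancel_mono ((S.θ hij hjk).hom.app ((S.F hkl).obj x) ≫
    (S.θ (hij.trans hjk) hkl).hom.app x), ← h]
  simp only [Category.assoc, ← Functor.map_comp_assoc, Iso.inv_hom_id_app,
    CategoryTheory.Functor.map_id]
  rw [h]
  simp

lemma Source.comm_inv {S : InverseSystem I C} {E : Type w'} [Category.{v'} E] (T : S.Source E)
    {i j k : I} (hij : i < j) (hjk : j < k) (x : E) :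
    (T.Θ (hij.trans hjk)).inv.app x ≫ (S.θ hij hjk).inv.app ((T.Φ k).obj x) =
      (T.Θ hij).inv.app x ≫ (S.F hij).map ((T.Θ hjk).inv.app x) := by
  have h := T.comm hij hjk x
  rw [← cancel_mono ((S.θ hij hjk).hom.app ((T.Φ k).obj x) ≫
    (T.Θ (hij.trans hjk)).hom.app x), ← h]
  simp only [Category.assoc, ← Functor.map_comp_assoc, Iso.inv_hom_id_app,
    CategoryTheory.Functor.map_id]
  rw [h]
  simp

/-- Objects `(x_i, f_ij)` of the concrete inverse limit. -/
structure Limit (S : InverseSystem I C) where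
  obj : ∀ i, C i
  iso : ∀ {i j : I} (h : i < j), (S.F h).obj (obj j) ≅ obj i
  comm : ∀ {i j k : I} (hij : i < j) (hjk : j < k),
    (S.F hij).map (iso hjk).hom ≫ (iso hij).hom =
      (S.θ hij hjk).hom.app (obj k) ≫ (iso (hij.trans hjk)).hom

namespace Limit

variable {S : InverseSystem I C}

/-- Morphisms `(s_i)` of the concrete inverse limit. -/
@[ext]
structure Hom (x y : S.Limit) where
  app : ∀ i, x.obj i ⟶ y.obj i
  comm : ∀ {i j : I} (h : i < j),
    (x.iso h).hom ≫ app i = (S.F h).map (app j) ≫ (y.iso h).hom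

/-- The concrete inverse limit category, with componentwise composition. -/
instance : Category S.Limit where
  Hom x y := Hom x y
  id x := { app := fun i => 𝟙 (x.obj i), comm := fun h => by simp }
  comp s r :=
    { app := fun i => s.app i ≫ r.app i
      comm := fun h => by
        rw [← Category.assoc, s.comm, Category.assoc, r.comm, Functor.map_comp, Category.assoc] }
  id_comp _ := Hom.ext (funext fun _ => Category.id_comp _)
  comp_id _ := Hom.ext (funext fun _ => Category.comp_id _)
  assoc _ _ _ := Hom.ext (funext fun _ => Category.assoc _ _ _)

section Preadditive

variable [∀ i, Preadditive (C i)] [∀ (i j : I) (h : i < j), (S.F h).Additive] (x y : S.Limit)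

/-- The additive subgroup of compatible families in the product of the Hom-groups. -/
def homSubgroup : AddSubgroup (∀ i, x.obj i ⟶ y.obj i) where
  carrier := {s | ∀ (i j : I) (h : i < j),
    (x.iso h).hom ≫ s i = (S.F h).map (s j) ≫ (y.iso h).hom}
  zero_mem' i j h := by simp
  add_mem' {s r} hs hr i j h := by simp [hs i j h, hr i j h]
  neg_mem' {s} hs i j h := by simp [hs i j h]

/-- Morphisms are compatible families. -/
def homEquiv : (x ⟶ y) ≃ homSubgroup x y where
  toFun s := ⟨s.app, fun _ _ h => s.comm h⟩
  invFun s := ⟨s.1, fun h => s.2 _ _ h⟩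
  left_inv _ := rfl
  right_inv _ := rfl

/-- The componentwise preadditive structure. -/
instance : Preadditive S.Limit where
  homGroup x y := (homEquiv x y).addCommGroup
  add_comp _ _ _ _ _ _ := Hom.ext (funext fun _ => Preadditive.add_comp _ _ _ _ _ _)
  comp_add _ _ _ _ _ _ := Hom.ext (funext fun _ => Preadditive.comp_add _ _ _ _ _ _)

variable (k : Type uR) [Ring k] [∀ i, Linear k (C i)]
  [∀ (i j : I) (h : i < j), (S.F h).Linear k]

/-- The componentwise `k`-linear structure. -/
instance : Linear k S.Limit where
  homModule x y :=
    { smul := fun r s => ⟨fun i => r • s.app i, fun h => by simp [s.comm h]⟩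
      one_smul := fun _ => Hom.ext (funext fun _ => one_smul _ _)
      mul_smul := fun _ _ _ => Hom.ext (funext fun _ => mul_smul _ _ _)
      smul_zero := fun _ => Hom.ext (funext fun _ => smul_zero _)
      smul_add := fun _ _ _ => Hom.ext (funext fun _ => smul_add _ _ _)
      add_smul := fun _ _ _ => Hom.ext (funext fun _ => add_smul _ _ _)
      zero_smul := fun _ => Hom.ext (funext fun _ => zero_smul _ _) }
  smul_comp _ _ _ _ _ _ := Hom.ext (funext fun _ => Linear.smul_comp _ _ _ _ _ _)
  comp_smul _ _ _ _ _ _ := Hom.ext (funext fun _ => Linear.comp_smul _ _ _ _ _ _)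

end Preadditive

end Limit

variable (S : InverseSystem I C)

/-- The concrete inverse limit, as a source. -/
def limitSource : S.Source S.Limit where
  Φ i := { obj := fun x => x.obj i, map := fun s => s.app i }
  Θ h := NatIso.ofComponents (fun x => x.iso h) (fun s => (s.comm h).symm)
  comm hij hjk x := x.comm hij hjk

/-- An object `x` of the concrete inverse limit is firm if there is `t` such that for all `u > t`
the functor `F_tu` is bijective on morphisms out of and into `Φ_u(x)`. -/
def isFirm : ObjectProperty S.Limit := fun x =>
  ∃ t : I, ∀ (u : I) (h : t < u),
    (∀ b : C u, Function.Bijective fun f : x.obj u ⟶ b => (S.F h).map f) ∧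
    (∀ a : C u, Function.Bijective fun f : a ⟶ x.obj u => (S.F h).map f)

/-- The full subcategory of firm objects. -/
abbrev Firm := S.isFirm.FullSubcategory

/-- The firm source: the restriction of the concrete inverse limit to the firm objects. -/
def firmSource : S.Source S.Firm where
  Φ i := S.isFirm.ι ⋙ S.limitSource.Φ i
  Θ h := Functor.isoWhiskerLeft S.isFirm.ι (S.limitSource.Θ h)
  comm hij hjk x := S.limitSource.comm hij hjk x.obj

section Linear

variable [∀ i, Preadditive (C i)] [∀ (i j : I) (h : i < j), (S.F h).Additive]

instance (i : I) : (S.limitSource.Φ i).Additive where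
  map_add := rfl

instance (i : I) : (S.firmSource.Φ i).Additive :=
  inferInstanceAs (S.isFirm.ι ⋙ S.limitSource.Φ i).Additive

variable (k : Type uR) [Ring k] [∀ i, Linear k (C i)]
  [∀ (i j : I) (h : i < j), (S.F h).Linear k]

instance (i : I) : (S.limitSource.Φ i).Linear k where
  map_smul _ _ := rfl

instance (i : I) : (S.firmSource.Φ i).Linear k where
  map_smul _ _ := rfl

end Linear

end InverseSystem

/-! ### Direct systems of categories and admissible targets -/

/-- A direct system of categories `(A_i, G_ij, ζ_ijk)` over `I`. -/
structure DirectSystem (I : Type u) [Preorder I] (A : I → Type w) [∀ i, Category.{v} (A i)] where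
  G : ∀ {i j : I}, i < j → (A i ⥤ A j)
  ζ : ∀ {i j k : I} (hij : i < j) (hjk : j < k), G hij ⋙ G hjk ≅ G (hij.trans hjk)
  comm : ∀ {i j k l : I} (hij : i < j) (hjk : j < k) (hkl : k < l) (x : A i),
    (G hkl).map ((ζ hij hjk).hom.app x) ≫ (ζ (hij.trans hjk) hkl).hom.app x =
      (ζ hjk hkl).hom.app ((G hij).obj x) ≫ (ζ hij (hjk.trans hkl)).hom.app x

/-- A target `(B, Ψ_i, Z_ij)` of a direct system. -/
structure DirectSystem.Target {I : Type u} [Preorder I] {A : I → Type w} [∀ i, Category.{v} (A i)]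
    (S : DirectSystem I A) (B : Type w') [Category.{v'} B] where
  Ψ : ∀ i, A i ⥤ B
  Z : ∀ {i j : I} (h : i < j), S.G h ⋙ Ψ j ≅ Ψ i
  comm : ∀ {i j k : I} (hij : i < j) (hjk : j < k) (x : A i),
    (Ψ k).map ((S.ζ hij hjk).hom.app x) ≫ (Z (hij.trans hjk)).hom.app x =
      (Z hjk).hom.app ((S.G hij).obj x) ≫ (Z hij).hom.app x

section Admissible

/-- A preadditive category is abelian. -/
structure IsAbelianCat (A : Type w) [Category.{v} A] [Preadditive A] : Prop where
  hasFiniteProducts : HasFiniteProducts A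
  hasKernels : HasKernels A
  hasCokernels : HasCokernels A
  isNormalMonoCategory : IsNormalMonoCategory A
  isNormalEpiCategory : IsNormalEpiCategory A

/-- The `Abelian` instance, extending the given preadditive structure. -/
@[reducible]
def IsAbelianCat.toAbelian {A : Type w} [Category.{v} A] [P : Preadditive A] (h : IsAbelianCat A) :
    Abelian A :=
  { P, h.isNormalMonoCategory, h.isNormalEpiCategory with
    has_finite_products := h.hasFiniteProducts
    has_kernels := h.hasKernels
    has_cokernels := h.hasCokernels }

/-- `Ext^n_A(x, y) ≅ Ext^n_B(x', y')` as `R`-modules, for `R`-linear abelian categories. -/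
def ExtIso (R : Type uR) [Ring R] {A : Type w} [Category.{v} A] [Preadditive A] [Linear R A]
    {B : Type w'} [Category.{v'} B] [Preadditive B] [Linear R B] (hA : IsAbelianCat A)
    (hB : IsAbelianCat B) (n : ℕ) (x y : A) (x' y' : B) : Prop :=
  letI := hA.toAbelian
  letI := hB.toAbelian
  haveI := HasExt.standard A
  haveI := HasExt.standard B
  Nonempty (Abelian.Ext.{max w v} x y n ≃ₗ[R] Abelian.Ext.{max w' v'} x' y' n)

/-- The target `T` of the direct system `S`, with the adjunctions `(L_i, Ψ_i)` and `(Ψ_i, K_i)`, is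
an admissible target. The first five fields express that `S` is a direct system of abelian
categories and fully faithful exact functors. The categories are linear over a base ring `R` and the
isomorphisms of `Ext`-groups are `R`-linear (for plain abelian categories, `R = ℤ`). -/
structure IsAdmissibleTarget (R : Type uR) [Ring R] {I : Type u} [Preorder I] {A : I → Type w}
    [∀ i, Category.{v} (A i)] [∀ i, Preadditive (A i)] [∀ i, Linear R (A i)]
    {S : DirectSystem I A} {B : Type w'} [Category.{v'} B] [Preadditive B] [Linear R B]
    (T : S.Target B) {L K : ∀ i, B ⥤ A i} (adjL : ∀ i, L i ⊣ T.Ψ i) (adjK : ∀ i, T.Ψ i ⊣ K i) :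
    Prop where
  abelian : ∀ i, IsAbelianCat (A i)
  full_G : ∀ {i j : I} (h : i < j), (S.G h).Full
  faithful_G : ∀ {i j : I} (h : i < j), (S.G h).Faithful
  preservesFiniteLimits_G : ∀ {i j : I} (h : i < j), PreservesFiniteLimits (S.G h)
  preservesFiniteColimits_G : ∀ {i j : I} (h : i < j), PreservesFiniteColimits (S.G h)
  abelian_target : IsAbelianCat B
  full : ∀ i, (T.Ψ i).Full
  faithful : ∀ i, (T.Ψ i).Faithful
  isIso_unit_counit : ∀ x : B, ∃ t : I, ∀ u : I, t < u →
    IsIso ((adjL u).unit.app x) ∧ IsIso ((adjK u).counit.app x)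
  ext_left : ∀ (x : B) (n : ℕ), 0 < n → ∃ t : I, ∀ u : I, t < u → ∀ (z : A u) (r : ℕ),
    0 < r → r < n →
      ExtIso R abelian_target (abelian u) r x ((T.Ψ u).obj z) ((L u).obj x) z
  ext_right : ∀ (y : B) (n : ℕ), 0 < n → ∃ t : I, ∀ u : I, t < u → ∀ (z : A u) (r : ℕ),
    0 < r → r < n →
      ExtIso R abelian_target (abelian u) r ((T.Ψ u).obj z) y z ((K u).obj y)

end Admissible

/-! ### The direct system of module categories and its target -/

section ModuleSystem

variable (k : Type u) [Field k]

/-- An isomorphism `η : G ∘ F ≅ H` induces an isomorphism `F_* ∘ G_* ≅ H_*`, whose component at `M`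
is `M(η⁻¹)`. -/
def fpRestrCompIso {C D E : Type u} [Category.{u} C] [Preadditive C] [Linear k C]
    [Category.{u} D] [Preadditive D] [Linear k D] [Category.{u} E] [Preadditive E] [Linear k E]
    {F : C ⥤ D} [F.Additive] [F.Linear k] {G : D ⥤ E} [G.Additive] [G.Linear k]
    {H : C ⥤ E} [H.Additive] [H.Linear k] (hF : IsCoherentPreserving k F)
    (hG : IsCoherentPreserving k G) (hH : IsCoherentPreserving k H) (η : F ⋙ G ≅ H) :
    fpRestr k hG ⋙ fpRestr k hF ≅ fpRestr k hH :=
  NatIso.ofComponents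
    (fun M => ObjectProperty.isoMk _ (ObjectProperty.isoMk _
      (Functor.isoWhiskerRight (NatIso.op η.symm) M.obj.obj)))
    (fun α => ObjectProperty.hom_ext _ (ObjectProperty.hom_ext _ (NatTrans.ext
      (funext fun X => (α.hom.hom.naturality (η.inv.app X.unop).op).symm))))

variable {I : Type u} [Preorder I] {C : I → Type u} [∀ i, Category.{u} (C i)]
  [∀ i, Preadditive (C i)] [∀ i, Linear k (C i)] {S : InverseSystem I C}
  [∀ (i j : I) (h : i < j), (S.F h).Additive] [∀ (i j : I) (h : i < j), (S.F h).Linear k]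

/-- The direct system `(mod C_i, F_ij*, θ_ijk*)`. -/
def modSystem (hF : ∀ (i j : I) (h : i < j), IsCoherentPreserving k (S.F h)) :
    DirectSystem I fun i => FPModCat k (C i) where
  G {i j} h := fpRestr k (hF i j h)
  ζ {i j l} hij hjl := fpRestrCompIso k (hF j l hjl) (hF i j hij) (hF i l _) (S.θ hij hjl)
  comm {i j l m} hij hjl hlm M := by
    refine ObjectProperty.hom_ext _ (ObjectProperty.hom_ext _ (NatTrans.ext (funext fun X => ?_)))
    refine (M.obj.obj.map_comp _ _).symm.trans (Eq.trans ?_ (M.obj.obj.map_comp _ _))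
    exact congrArg (fun q => M.obj.obj.map q.op) (S.comm_inv hij hjl hlm X.unop)

/-- The target `(mod E, Φ_i*, Θ_ij*)` given by a source `(E, Φ_i, Θ_ij)`. -/
def modTarget (hF : ∀ (i j : I) (h : i < j), IsCoherentPreserving k (S.F h))
    {E : Type u} [Category.{u} E] [Preadditive E] [Linear k E] (T : S.Source E)
    [∀ i, (T.Φ i).Additive] [∀ i, (T.Φ i).Linear k]
    (hΦ : ∀ i, IsCoherentPreserving k (T.Φ i)) :
    (modSystem k hF).Target (FPModCat k E) where
  Ψ i := fpRestr k (hΦ i)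
  Z {i j} h := fpRestrCompIso k (hΦ j) (hF i j h) (hΦ i) (T.Θ h)
  comm {i j l} hij hjl M := by
    refine ObjectProperty.hom_ext _ (ObjectProperty.hom_ext _ (NatTrans.ext (funext fun X => ?_)))
    refine (M.obj.obj.map_comp _ _).symm.trans (Eq.trans ?_ (M.obj.obj.map_comp _ _))
    exact congrArg (fun q => M.obj.obj.map q.op) (T.comm_inv hij hjl X.unop)

end ModuleSystem

end
end AdmTarget

/-! Everything rests on one fact: each finitely presented module `M` over the firm source lies in
the essential image of `Φ_u*` for all large `u`. Such an `M` is generated by a single element of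
`M(x)` with `x` firm. If `t` witnesses firmness and `u > t`, two maps into `x` that agree at `u`
agree at `t`, hence at every `w > t` by injectivity of `F_tw`, hence everywhere when the index set
has no maximal element (`InverseSystem.exists_hom_ext_of_isFirm`). So a morphism killed by `Φ_u`
annihilates `M` (`exists_annihilatedByKer`). As `Φ_u` is full, such an `M` satisfies `M ≅ Φ_u* Φ_u^*
M` (`isIso_indAdj_unit_app`). If the index set has a maximal element, every "for all `u > t`"
condition is vacuous for a suitable `t`.

The rest is formal. Restriction along a full dense functor is fully faithful, and its adjoints on
both sides make it exact. The `F_ij` inherit fullness and density from `Φ_j ⋙ F_ij ≅ Φ_i`. Units and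
counits at `M` are isomorphisms exactly when `M` is in the essential image.

For `Ext`, the duality gives `mod` of the firm source enough projectives and injectives. In a
projective presentation of `x`, both the projective and the kernel eventually come from `mod C_u`,
and the preimage of a projective is again projective. The long exact sequences then compare `Ext` in
degree `n + 1` with degree `n` (`exists_mapExt_bijective_left`), and dually for injectives. The
bound on the degree allows finitely many choices of threshold, which directedness combines. -/

namespace AdmTarget

noncomputable section

/-! ### Closure under finite products. -/

section Biproducts

variable {A : Type w} [Category.{v} A] [Preadditive A] [HasFiniteProducts A]

/-- A property of objects of an additive category that contains a zero object and is closed under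
isomorphisms and binary biproducts is closed under finite products. -/
lemma isClosedUnderFiniteProducts_of_biprod (P : ObjectProperty A) [P.IsClosedUnderIsomorphisms]
    [P.ContainsZero] [HasBinaryBiproducts A] (h : ∀ X Y : A, P X → P Y → P (X ⊞ Y)) :
    P.IsClosedUnderFiniteProducts := by
  have : P.IsClosedUnderBinaryProducts := by
    refine ⟨?_⟩
    rintro X ⟨p⟩
    have e : p.diag.obj ⟨.left⟩ ⊞ p.diag.obj ⟨.right⟩ ≅ X :=
      (BinaryBiproduct.isLimit _ _).conePointsIsoOfNatIso p.isLimit (diagramIsoPair p.diag).symm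
    exact P.prop_of_iso e (h _ _ (p.prop_diag_obj _) (p.prop_diag_obj _))
  exact .mk'

end Biproducts

/-! ### `Mod C` as an abelian category with pointwise exactness. -/

section ModCat

variable (k : Type u) [Field k] (C : Type u) [Category.{u} C] [Preadditive C] [Linear k C]

/-- Additivity and linearity are identities between maps, so they can be checked after composing
with a monomorphism (or an epimorphism, for quotients). Together with closure under finite products
this makes `Mod C` abelian with exact inclusion into all functors. -/
instance isModule_isClosedUnderSubobjects : (isModule k C).IsClosedUnderSubobjects where
  prop_of_mono {K M} i _ hM := by
    obtain ⟨h1, h2⟩ := hM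
    have (X : Cᵒᵖ) : Mono (i.app X) := inferInstance
    refine ⟨⟨fun {X Y f g} => ?_⟩, ⟨fun {X Y} f r => ?_⟩⟩
    · rw [← cancel_mono (i.app Y)]
      simp [Preadditive.add_comp, M.map_add]
    · rw [← cancel_mono (i.app Y)]
      simp [h2.map_smul]

instance isModule_isClosedUnderQuotients : (isModule k C).IsClosedUnderQuotients where
  prop_of_epi {M K} p _ hM := by
    obtain ⟨h1, h2⟩ := hM
    have (X : Cᵒᵖ) : Epi (p.app X) := inferInstance
    refine ⟨⟨fun {X Y f g} => ?_⟩, ⟨fun {X Y} f r => ?_⟩⟩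
    · rw [← cancel_epi (p.app X), ← p.naturality, M.map_add, Preadditive.comp_add,
        Preadditive.add_comp, p.naturality, p.naturality]
    · rw [← cancel_epi (p.app X), ← p.naturality, h2.map_smul, Linear.comp_smul,
        Linear.smul_comp, p.naturality]

instance isModule_containsZero : (isModule k C).ContainsZero where
  exists_zero := by
    obtain ⟨Z, hZ⟩ := HasZeroObject.zero (C := Cᵒᵖ ⥤ ModuleCat.{u} k)
    have h (X : Cᵒᵖ) : IsZero (Z.obj X) := hZ.obj X
    exact ⟨Z, hZ, ⟨fun {X Y f g} => (h _).eq_of_src _ _⟩, ⟨fun {X Y} f r => (h _).eq_of_src _ _⟩⟩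

lemma isModule_biprod {M N : Cᵒᵖ ⥤ ModuleCat.{u} k} (hM : isModule k C M) (hN : isModule k C N) :
    isModule k C (M ⊞ N) := by
  obtain ⟨h1, h2⟩ := hM
  obtain ⟨h3, h4⟩ := hN
  -- The action on the biproduct is block diagonal, hence visibly additive and linear in `f`.
  have key {X Y : Cᵒᵖ} (f : X ⟶ Y) : (M ⊞ N).map f =
      (biprod.fst : M ⊞ N ⟶ M).app X ≫ M.map f ≫ (biprod.inl : M ⟶ M ⊞ N).app Y +
        (biprod.snd : M ⊞ N ⟶ N).app X ≫ N.map f ≫ (biprod.inr : N ⟶ M ⊞ N).app Y := by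
    have := congrArg (fun q => q.app Y) (biprod.total (X := M) (Y := N))
    rw [← NatTrans.naturality_assoc, ← NatTrans.naturality_assoc, ← Preadditive.comp_add]
    exact (Category.comp_id _).symm.trans (congrArg ((M ⊞ N).map f ≫ ·) this.symm)
  refine ⟨⟨fun {X Y f g} => ?_⟩, ⟨fun {X Y} f r => ?_⟩⟩
  · rw [key, key, key, M.map_add, N.map_add]
    simp only [Preadditive.add_comp, Preadditive.comp_add]
    abel
  · rw [key, key, h2.map_smul, h4.map_smul]
    simp

instance isModule_isClosedUnderFiniteProducts : (isModule k C).IsClosedUnderFiniteProducts :=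
  isClosedUnderFiniteProducts_of_biprod _ fun _ _ => isModule_biprod k C

instance isModule_preservesFiniteLimits_ι : PreservesFiniteLimits (isModule k C).ι := by
  have := (isModule k C).preservesKernels_ι
  exact Functor.preservesFiniteLimits_of_preservesKernels _

instance isModule_preservesFiniteColimits_ι : PreservesFiniteColimits (isModule k C).ι := by
  have := (isModule k C).preservesCokernels_ι
  exact Functor.preservesFiniteColimits_of_preservesCokernels _

/-- Evaluation of modules at an object. -/
abbrev evalMod (c : Cᵒᵖ) : ModCat k C ⥤ ModuleCat.{u} k :=
  (isModule k C).ι ⋙ (evaluation _ _).obj c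

variable {k C}

lemma ModCat.exact_app {S : ShortComplex (ModCat k C)} (h : S.Exact) (c : Cᵒᵖ) :
    Function.Exact (S.f.hom.app c).hom (S.g.hom.app c).hom :=
  (ShortComplex.ShortExact.moduleCat_exact_iff_function_exact _).1 (h.map (evalMod k C c))

lemma ModCat.injective_app {M N : ModCat k C} (f : M ⟶ N) [Mono f] (c : Cᵒᵖ) :
    Function.Injective (f.hom.app c).hom :=
  (ModuleCat.mono_iff_injective _).1 (inferInstanceAs (Mono ((evalMod k C c).map f)))

lemma ModCat.surjective_app {M N : ModCat k C} (f : M ⟶ N) [Epi f] (c : Cᵒᵖ) :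
    Function.Surjective (f.hom.app c).hom :=
  (ModuleCat.epi_iff_surjective _).1 (inferInstanceAs (Epi ((evalMod k C c).map f)))

lemma ModCat.mono_of_injective_app {M N : ModCat k C} (f : M ⟶ N)
    (h : ∀ c, Function.Injective (f.hom.app c).hom) : Mono f :=
  have (c : Cᵒᵖ) : Mono (((isModule k C).ι.map f).app c) := (ModuleCat.mono_iff_injective _).2 (h c)
  have : Mono ((isModule k C).ι.map f) := NatTrans.mono_of_mono_app _
  (isModule k C).ι.mono_of_mono_map this

lemma ModCat.epi_of_surjective_app {M N : ModCat k C} (f : M ⟶ N)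
    (h : ∀ c, Function.Surjective (f.hom.app c).hom) : Epi f :=
  have (c : Cᵒᵖ) : Epi (((isModule k C).ι.map f).app c) := (ModuleCat.epi_iff_surjective _).2 (h c)
  have : Epi ((isModule k C).ι.map f) := NatTrans.epi_of_epi_app _
  (isModule k C).ι.epi_of_epi_map this

lemma ModCat.isIso_of_bijective_app {M N : ModCat k C} (f : M ⟶ N)
    (h : ∀ c, Function.Bijective (f.hom.app c).hom) : IsIso f :=
  have := ModCat.mono_of_injective_app f fun c => (h c).1
  have := ModCat.epi_of_surjective_app f fun c => (h c).2
  isIso_of_mono_of_epi f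

end ModCat

/-! ### Finitely presented modules: generators, relations, cokernels and biproducts. -/

section FP

open scoped ZeroObject

variable {k : Type u} [Field k] {C : Type u} [Category.{u} C] [Preadditive C] [Linear k C]

lemma ModCat.map_add_apply (M : ModCat k C) {x y : C} (f g : x ⟶ y) (m : M.obj.obj (op y)) :
    (M.obj.map (f + g).op).hom m = (M.obj.map f.op).hom m + (M.obj.map g.op).hom m :=
  have := M.property.1
  congrArg (fun q => q.hom m) (M.obj.map_add (f := f.op) (g := g.op))

lemma ModCat.map_sub_apply (M : ModCat k C) {x y : C} (f g : x ⟶ y) (m : M.obj.obj (op y)) :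
    (M.obj.map (f - g).op).hom m = (M.obj.map f.op).hom m - (M.obj.map g.op).hom m :=
  have := M.property.1
  congrArg (fun q => q.hom m) (M.obj.map_sub (f := f.op) (g := g.op))

lemma ModCat.map_smul_apply (M : ModCat k C) {x y : C} (r : k) (f : x ⟶ y) (m : M.obj.obj (op y)) :
    (M.obj.map (r • f).op).hom m = r • (M.obj.map f.op).hom m :=
  congrArg (fun q => q.hom m) (M.property.2.map_smul f.op r)

lemma ModCat.map_comp_apply (M : ModCat k C) {x y z : C} (f : x ⟶ y) (g : y ⟶ z)
    (m : M.obj.obj (op z)) :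
    (M.obj.map (f ≫ g).op).hom m = (M.obj.map f.op).hom ((M.obj.map g.op).hom m) :=
  congrArg (fun q => q.hom m) (M.obj.map_comp g.op f.op)

lemma ModCat.naturality_apply {M N : ModCat k C} (α : M ⟶ N) {x y : C} (f : x ⟶ y)
    (m : M.obj.obj (op y)) :
    (α.hom.app (op x)).hom ((M.obj.map f.op).hom m) =
      (N.obj.map f.op).hom ((α.hom.app (op y)).hom m) :=
  congrArg (fun q => q.hom m) (α.hom.naturality f.op)

lemma yonedaMod_hom_app (M : ModCat k C) {x : C} (p : (yonedaMod k C).obj x ⟶ M) {c : C}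
    (h : c ⟶ x) : (p.hom.app (op c)).hom h =
      (M.obj.map h.op).hom ((p.hom.app (op x)).hom (show x ⟶ x from 𝟙 x)) :=
  (congrArg (p.hom.app (op c)).hom (Category.comp_id h).symm).trans
    (ModCat.naturality_apply p h (show x ⟶ x from 𝟙 x))

/-- `m ∈ M(x)` generates the module `M`. -/
def Generates {M : ModCat k C} {x : C} (m : M.obj.obj (op x)) : Prop :=
  ∀ (c : C) (n : M.obj.obj (op c)), ∃ h : c ⟶ x, (M.obj.map h.op).hom m = n

/-- The annihilator of `m ∈ M(x)` is generated by `r : y ⟶ x`. -/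
def AnnGeneratedBy {M : ModCat k C} {x y : C} (m : M.obj.obj (op x)) (r : y ⟶ x) : Prop :=
  ∀ (c : C) (h : c ⟶ x), (M.obj.map h.op).hom m = 0 ↔ ∃ g : c ⟶ y, g ≫ r = h

/-- A module is finitely presented if and only if it is generated by one element whose annihilator
is generated by one morphism. -/
lemma isFP_iff (M : ModCat k C) : isFP k C M ↔ ∃ (x y : C) (r : y ⟶ x) (m : M.obj.obj (op x)),
    Generates m ∧ AnnGeneratedBy m r := by
  constructor
  · rintro ⟨x, y, f, p, h⟩
    refine ⟨x, y, (f.hom.app (op y)).hom (show y ⟶ y from 𝟙 y),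
      (p.hom.app (op x)).hom (show x ⟶ x from 𝟙 x), fun c n => ?_, fun c g => ?_⟩
    · obtain ⟨g, hg⟩ := (h (op c)).2 n
      exact ⟨g, (yonedaMod_hom_app M p g).symm.trans hg⟩
    · rw [← yonedaMod_hom_app M p g]
      refine ((h (op c)).1 g).trans ⟨?_, ?_⟩
      · rintro ⟨g', hg'⟩
        exact ⟨g', (yonedaMod_hom_app _ f g').symm.trans hg'⟩
      · rintro ⟨g', hg'⟩
        exact ⟨g', (yonedaMod_hom_app _ f g').trans hg'⟩
  · rintro ⟨x, y, r, m, h1, h2⟩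
    refine ⟨x, y, (yonedaMod k C).map r, yonedaHom k M x m, fun c => ⟨fun g => ?_, fun n => ?_⟩⟩
    · exact h2 _ g
    · exact h1 _ n

lemma isFP_yonedaMod [HasZeroObject C] (x : C) : isFP k C ((yonedaMod k C).obj x) := by
  -- A representable is free on the identity of `x`; the zero object serves as the source of the
  -- empty set of relations.
  refine (isFP_iff _).2 ⟨x, 0, 0, (show x ⟶ x from 𝟙 x), fun c n => ⟨n, Category.comp_id _⟩,
    fun c h => ?_⟩
  constructor
  · intro h0
    exact ⟨0, zero_comp.trans ((Category.comp_id h).symm.trans h0).symm⟩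
  · rintro ⟨g, rfl⟩
    exact (Category.comp_id (g ≫ _)).trans comp_zero

instance : (isFP k C).IsClosedUnderIsomorphisms where
  of_iso {M N} e := by
    rintro ⟨x, y, f, p, h⟩
    have hb (c : Cᵒᵖ) : Function.Bijective (e.hom.hom.app c).hom :=
      ⟨ModCat.injective_app e.hom c, ModCat.surjective_app e.hom c⟩
    refine ⟨x, y, f, p ≫ e.hom, fun c => ⟨fun g => ?_, (hb c).2.comp (h c).2⟩⟩
    refine Iff.trans ?_ ((h c).1 g)
    exact (map_eq_zero_iff (e.hom.hom.app c).hom (hb c).1)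

instance [HasZeroObject C] : (isFP k C).ContainsZero where
  exists_zero := by
    obtain ⟨Z, hZ⟩ := HasZeroObject.zero (C := ModCat k C)
    have hs (c : Cᵒᵖ) (z : Z.obj.obj c) : z = 0 :=
      congrArg (fun q => (q.hom.app c).hom z) (hZ.eq_of_src (𝟙 Z) 0)
    refine ⟨Z, hZ, (isFP_iff _).2 ⟨0, 0, 𝟙 0, 0, fun c n => ⟨0, ?_⟩, fun c h => ⟨?_, ?_⟩⟩⟩
    · rw [hs _ n]; exact hs _ _
    · exact fun _ => ⟨h, Category.comp_id h⟩
    · exact fun _ => hs _ _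

variable [HasBinaryBiproducts C]

/-- Finitely presented modules are closed under cokernels. -/
lemma isFP_of_exact {N M L : ModCat k C} (f : N ⟶ M) (g : M ⟶ L)
    (hfg : ∀ c, Function.Exact (f.hom.app c).hom (g.hom.app c).hom)
    (hg : ∀ c, Function.Surjective (g.hom.app c).hom) (hN : isFP k C N) (hM : isFP k C M) :
    isFP k C L := by
  obtain ⟨x', y', r', n, hn, -⟩ := (isFP_iff _).1 hN
  obtain ⟨x, y, r, m, hm, hr⟩ := (isFP_iff _).1 hM
  -- Since `m` generates `M`, the image of the generator `n` is `m` acted on by some `s`. The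
  -- quotient is then generated by the image of `m`, with the old relation `r` and the new relation
  -- `s`. Only a generator of `N` is needed, not its relations.
  obtain ⟨s, hs⟩ := hm _ ((f.hom.app _).hom n)
  refine (isFP_iff _).2 ⟨x, y ⊞ x', biprod.desc r s, (g.hom.app _).hom m, fun c l => ?_,
    fun c h => ?_⟩
  · obtain ⟨m', rfl⟩ := hg _ l
    obtain ⟨h, rfl⟩ := hm _ m'
    exact ⟨h, (ModCat.naturality_apply g h m).symm⟩
  · rw [← ModCat.naturality_apply g h m, hfg (op c) ((M.obj.map h.op).hom m)]
    constructor
    -- If `h` takes `m` into the image of `N`, it agrees there with some `t ≫ s`; the difference `h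
    -- - t ≫ s` annihilates `m` and so factors through `r`.
    · rintro ⟨n', hn'⟩
      obtain ⟨t, rfl⟩ := hn _ n'
      rw [ModCat.naturality_apply, ← hs, ← ModCat.map_comp_apply, eq_comm, ← sub_eq_zero,
        ← ModCat.map_sub_apply] at hn'
      obtain ⟨a, ha⟩ := (hr _ _).1 hn'
      exact ⟨biprod.lift a t, by simp [ha]⟩
    · rintro ⟨a, rfl⟩
      refine ⟨(N.obj.map (a ≫ biprod.snd).op).hom n, ?_⟩
      have h0 : (M.obj.map ((a ≫ biprod.fst) ≫ r).op).hom m = 0 := (hr _ _).2 ⟨_, rfl⟩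
      rw [ModCat.naturality_apply, ← hs, ← ModCat.map_comp_apply]
      have : a ≫ biprod.desc r s = (a ≫ biprod.fst) ≫ r + (a ≫ biprod.snd) ≫ s := by
        simp [biprod.desc_eq]
      rw [this, ModCat.map_add_apply, h0, zero_add]

instance : (isFP k C).IsClosedUnderCokernels where
  cokernels_le := by
    rintro L ⟨f, c, hc, hM, hN⟩
    have : Epi c.π := Cofork.IsColimit.epi hc
    have h : (ShortComplex.mk f c.π c.condition).Exact :=
      ShortComplex.exact_of_g_is_cokernel _
        (hc.ofIsoColimit (Cofork.ext (Iso.refl _)))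
    exact isFP_of_exact f c.π (ModCat.exact_app h) (ModCat.surjective_app c.π) hM hN

lemma isFP_biprod {M N : ModCat k C} (hM : isFP k C M) (hN : isFP k C N) :
    isFP k C (M ⊞ N) := by
  obtain ⟨x, y, r, m, hm, hr⟩ := (isFP_iff _).1 hM
  obtain ⟨x', y', r', n, hn, hr'⟩ := (isFP_iff _).1 hN
  let il := fun c => ((biprod.inl : M ⟶ M ⊞ N).hom.app c).hom
  let ir := fun c => ((biprod.inr : N ⟶ M ⊞ N).hom.app c).hom
  let pl := fun c => ((biprod.fst : M ⊞ N ⟶ M).hom.app c).hom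
  let pr := fun c => ((biprod.snd : M ⊞ N ⟶ N).hom.app c).hom
  have tot (c) (z : (M ⊞ N).obj.obj c) : z = il c (pl c z) + ir c (pr c z) :=
    (congrArg (fun q => (q.hom.app c).hom z) (biprod.total (X := M) (Y := N))).symm
  have hll (c) (z) : pl c (il c z) = z :=
    congrArg (fun q => (q.hom.app c).hom z) (biprod.inl_fst (X := M) (Y := N))
  have hrr (c) (z) : pr c (ir c z) = z :=
    congrArg (fun q => (q.hom.app c).hom z) (biprod.inr_snd (X := M) (Y := N))
  have hlr (c) (z) : pr c (il c z) = 0 :=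
    congrArg (fun q => (q.hom.app c).hom z) (biprod.inl_snd (X := M) (Y := N))
  have hrl (c) (z) : pl c (ir c z) = 0 :=
    congrArg (fun q => (q.hom.app c).hom z) (biprod.inr_fst (X := M) (Y := N))
  -- The candidate generator lives at `x ⊞ x'`, and a map `h` acts on its two summands through the
  -- two components of `h`; generation and relations are then checked componentwise.
  have key {c : C} (h : c ⟶ x ⊞ x') : ((M ⊞ N).obj.map h.op).hom
      (il _ ((M.obj.map biprod.fst.op).hom m) + ir _ ((N.obj.map biprod.snd.op).hom n)) =
      il _ ((M.obj.map (h ≫ biprod.fst).op).hom m) +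
        ir _ ((N.obj.map (h ≫ biprod.snd).op).hom n) := by
    rw [map_add, ← ModCat.naturality_apply, ← ModCat.naturality_apply, ModCat.map_comp_apply,
      ModCat.map_comp_apply]
  refine (isFP_iff _).2 ⟨x ⊞ x', y ⊞ y', biprod.map r r', il _ ((M.obj.map biprod.fst.op).hom m) +
    ir _ ((N.obj.map biprod.snd.op).hom n), fun c z => ?_, fun c h => ?_⟩
  · obtain ⟨h, hh⟩ := hm _ (pl _ z)
    obtain ⟨h', hh'⟩ := hn _ (pr _ z)
    refine ⟨biprod.lift h h', ?_⟩
    rw [key, biprod.lift_fst, biprod.lift_snd, hh, hh', ← tot]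
  · rw [key]
    have : il (op c) ((M.obj.map (h ≫ biprod.fst).op).hom m) +
        ir (op c) ((N.obj.map (h ≫ biprod.snd).op).hom n) = 0 ↔
        (M.obj.map (h ≫ biprod.fst).op).hom m = 0 ∧ (N.obj.map (h ≫ biprod.snd).op).hom n = 0 := by
      constructor
      · intro h0
        constructor
        · have := congrArg (pl _) h0
          rwa [map_add, hll, hrl, add_zero, map_zero] at this
        · have := congrArg (pr _) h0
          rwa [map_add, hlr, hrr, zero_add, map_zero] at this
      · rintro ⟨h1, h2⟩
        rw [h1, h2, map_zero, map_zero, add_zero]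
    rw [this, hr, hr']
    constructor
    · rintro ⟨⟨a, ha⟩, ⟨b, hb⟩⟩
      exact ⟨biprod.lift a b, by ext <;> simp [ha, hb]⟩
    · rintro ⟨a, rfl⟩
      exact ⟨⟨a ≫ biprod.fst, by simp⟩, ⟨a ≫ biprod.snd, by simp⟩⟩

instance [HasZeroObject C] : (isFP k C).IsClosedUnderFiniteProducts :=
  isClosedUnderFiniteProducts_of_biprod _ fun _ _ => isFP_biprod

end FP

/-! ### Consequences of the duality: kernels, projectives and injectives in `mod C`. -/

section Dualizing

variable {k : Type u} [Field k] {C : Type u} [Category.{u} C] [Preadditive C] [Linear k C]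

/-- The evaluation map `M ⟶ D D M`. -/
def doubleDualHom (M : ModCat k C) : M ⟶ (modDualOp k C).obj (op ((modDual k C).obj (op M))) :=
  ObjectProperty.homMk
    { app := fun X => ModuleCat.ofHom (Module.Dual.eval k (M.obj.obj X))
      naturality := fun _ _ _ => rfl }

lemma finite_of_isFP (hC : ∀ x y : C, Module.Finite k (x ⟶ y)) {M : ModCat k C}
    (hM : isFP k C M) (c : Cᵒᵖ) : Module.Finite k (M.obj.obj c) := by
  obtain ⟨x, y, f, p, h⟩ := hM
  have : Module.Finite k (((yonedaMod k C).obj x).obj.obj c) := hC c.unop x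
  exact Module.Finite.of_surjective (p.hom.app c).hom (h c).2

lemma isIso_doubleDualHom {M : ModCat k C} (hM : ∀ c, Module.Finite k (M.obj.obj c)) :
    IsIso (doubleDualHom M) :=
  ModCat.isIso_of_bijective_app _ fun c =>
    have := hM c
    Module.bijective_dual_eval k (M.obj.obj c)

lemma dualMap_exact {U V W : Type*} [AddCommGroup U] [Module k U] [AddCommGroup V] [Module k V]
    [AddCommGroup W] [Module k W] {f : U →ₗ[k] V} {g : V →ₗ[k] W} (h : Function.Exact f g) :
    Function.Exact g.dualMap f.dualMap := by
  rw [LinearMap.exact_iff] at h ⊢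
  rw [LinearMap.range_dualMap_eq_dualAnnihilator_ker, h,
    LinearMap.ker_dualMap_eq_dualAnnihilator_range]

/-- Duality turns the kernel into a cokernel over `Cᵒᵖ`, where finite presentation is preserved.
Hom-finiteness makes the kernel pointwise finite-dimensional, so dualizing back recovers it. -/
lemma IsDualizingVariety.isClosedUnderKernels (h : IsDualizingVariety k C) :
    (isFP k C).IsClosedUnderKernels where
  kernels_le := by
    rintro K ⟨f, c, hc, hM, hN⟩
    have := h.krullSchmidt.hasFiniteBiproducts
    have := hasBinaryBiproducts_of_finite_biproducts C
    have : Mono c.ι := Fork.IsLimit.mono hc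
    have hex : (ShortComplex.mk c.ι f c.condition).Exact :=
      ShortComplex.exact_of_f_is_kernel _ (hc.ofIsoLimit (Fork.ext (Iso.refl _)))
    have hfin (x : Cᵒᵖ) : Module.Finite k (c.pt.obj.obj x) :=
      have := finite_of_isFP h.homFinite hM x
      Module.Finite.of_injective (c.ι.hom.app x).hom (ModCat.injective_app c.ι x)
    -- Dualizing `0 → K → M → N` gives the exact sequence `DN → DM → DK → 0`.
    have hK : isFP k Cᵒᵖ ((modDual k C).obj (op c.pt)) :=
      isFP_of_exact ((modDual k C).map f.op) ((modDual k C).map c.ι.op)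
        (fun x => dualMap_exact (ModCat.exact_app hex x.unop))
        (fun x => LinearMap.dualMap_surjective_of_injective (ModCat.injective_app c.ι x.unop))
        (h.dual_mem ⟨_, hN⟩) (h.dual_mem ⟨_, hM⟩)
    have := isIso_doubleDualHom hfin
    exact (isFP k C).prop_of_iso (asIso (doubleDualHom c.pt)).symm (h.dualOp_mem ⟨_, hK⟩)

/-- The cokernel taken in `Mod C` is again finitely presented, so an epimorphism of `mod C` stays
one in `Mod C`. Closure under kernels is not needed. -/
lemma FPModCat.surjective_app [HasZeroObject C] [HasBinaryBiproducts C] {M N : FPModCat k C}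
    (f : M ⟶ N) [Epi f] (c : Cᵒᵖ) : Function.Surjective (f.hom.hom.app c).hom := by
  have := (isFP k C).preservesEpimorphisms_ι_of_isNormalMonoCategory
  exact ModCat.surjective_app ((isFP k C).ι.map f) c

/-- The first term of a presentation is representable, and representables are projective by Yoneda
and pointwise surjectivity of epimorphisms. No duality enters, so this also applies to `Cᵒᵖ`. -/
lemma FPModCat.enoughProjectives [HasZeroObject C] [HasBinaryBiproducts C] :
    EnoughProjectives (FPModCat k C) where
  presentation M := by
    obtain ⟨x, y, f, p, h⟩ := M.property
    let P : FPModCat k C := ⟨(yonedaMod k C).obj x, isFP_yonedaMod x⟩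
    have hp : Epi p := ModCat.epi_of_surjective_app p fun c => (h c).2
    let p' : P ⟶ M := ObjectProperty.homMk p
    refine ⟨{ p := P, f := p', epi := (isFP k C).ι.epi_of_epi_map hp, projective := ⟨?_⟩ }⟩
    intro A B φ e he
    obtain ⟨a, ha⟩ := FPModCat.surjective_app e (op x)
      ((φ.hom.hom.app (op x)).hom (show x ⟶ x from 𝟙 x))
    refine ⟨ObjectProperty.homMk (yonedaHom k A.obj x a), ?_⟩
    refine ObjectProperty.hom_ext _ (ObjectProperty.hom_ext _ (NatTrans.ext (funext fun c => ?_)))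
    ext (g : c.unop ⟶ x)
    refine (ModCat.naturality_apply e.hom g a).trans ?_
    rw [ha]
    exact (yonedaMod_hom_app _ φ.hom g).symm

variable (h : IsDualizingVariety k C)
include h

lemma IsDualizingVariety.isAbelianCat : IsAbelianCat (FPModCat k C) := by
  have := h.krullSchmidt.hasFiniteBiproducts
  have := hasBinaryBiproducts_of_finite_biproducts C
  have : HasZeroObject C := hasZeroObject_of_hasFiniteBiproducts C
  have := h.isClosedUnderKernels
  exact ⟨inferInstance, inferInstance, inferInstance, inferInstance, inferInstance⟩

lemma IsDualizingVariety.enoughProjectives : EnoughProjectives (FPModCat k C) := by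
  have := h.krullSchmidt.hasFiniteBiproducts
  have := hasBinaryBiproducts_of_finite_biproducts C
  have : HasZeroObject C := hasZeroObject_of_hasFiniteBiproducts C
  exact FPModCat.enoughProjectives

/-- The duality identifies `mod C` with the opposite of `mod Cᵒᵖ`, which has enough projectives. -/
lemma IsDualizingVariety.enoughInjectives : EnoughInjectives (FPModCat k C) := by
  have := h.krullSchmidt.hasFiniteBiproducts
  have := hasBinaryBiproducts_of_finite_biproducts C
  have : HasZeroObject C := hasZeroObject_of_hasFiniteBiproducts C
  have : EnoughProjectives (FPModCat k Cᵒᵖ) := FPModCat.enoughProjectives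
  have := h.isEquivalence_dualOp
  exact (Functor.asEquivalence ((isFP k C).lift ((isFP k Cᵒᵖ).ι.op ⋙ modDualOp k C)
    fun N => h.dualOp_mem N.unop)).enoughInjectives_iff.1 inferInstance

end Dualizing

/-! ### Full dense functors and modules annihilated by a kernel. -/

section Whiskering

/-- Restriction along a full and essentially surjective functor is full. -/
lemma whiskerLeft_surjective {C D E : Type*} [Category* C] [Category* D] [Category* E] (F : C ⥤ D)
    [F.Full] [F.EssSurj] (M N : D ⥤ E) :
    Function.Surjective fun α : M ⟶ N => Functor.whiskerLeft F α := by
  intro γ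
  let e (c : D) := F.objObjPreimageIso c
  -- By fullness `γ` commutes with every morphism of `D` between objects in the image of `F`. This
  -- makes the transport of `γ` along the chosen isomorphisms natural, and makes it agree with `γ`
  -- on the image of `F`.
  have hγ {x y : C} (f : F.obj x ⟶ F.obj y) : M.map f ≫ γ.app y = γ.app x ≫ N.map f := by
    obtain ⟨f, rfl⟩ := F.map_surjective f
    exact γ.naturality f
  refine ⟨{ app := fun c => M.map (e c).inv ≫ γ.app (F.objPreimage c) ≫ N.map (e c).hom
            naturality := fun c d f => ?_ }, ?_⟩
  · have h := hγ ((e c).hom ≫ f ≫ (e d).inv)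
    rw [← cancel_epi (M.map (e c).hom), ← cancel_mono (N.map (e d).inv)]
    simpa [← Functor.map_comp, ← Functor.map_comp_assoc] using h
  · ext x
    have h := hγ (e (F.obj x)).inv
    dsimp
    rw [reassoc_of% h, ← N.map_comp, Iso.inv_hom_id, N.map_id, Category.comp_id]

end Whiskering

section Annihilated

variable {k : Type u} [Field k] {C D : Type u} [Category.{u} C] [Preadditive C] [Linear k C]
  [Category.{u} D] [Preadditive D] (F : C ⥤ D)

/-- `M` is annihilated by the kernel of `F`. -/
def AnnihilatedByKer (M : ModCat k C) : Prop :=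
  ∀ ⦃x y : C⦄ (f : x ⟶ y), F.map f = 0 → M.obj.map f.op = 0

lemma AnnihilatedByKer.map_eq {F : C ⥤ D} [F.Additive] {M : ModCat k C} (hM : AnnihilatedByKer F M) {x y : C} {f g : x ⟶ y}
    (h : F.map f = F.map g) : M.obj.map f.op = M.obj.map g.op := by
  have := M.property.1
  rw [← sub_eq_zero, ← M.obj.map_sub, ← op_sub]
  exact hM _ (by rw [F.map_sub, h, sub_self])

end Annihilated

/-! ### Induction and restriction along a functor. -/

section Induced

variable {k : Type u} [Field k] {C D : Type u} [Category.{u} C] [Preadditive C] [Linear k C]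
  [Category.{u} D] [Preadditive D] [Linear k D] (F : C ⥤ D) [F.Additive] [F.Linear k]

/-- The map `C(-, x) ⟶ D(F(-), F(x))` given by `F`. -/
def yonedaModMap (x : C) :
    (yonedaMod k C).obj x ⟶ (restr k F).obj ((yonedaMod k D).obj (F.obj x)) :=
  ObjectProperty.homMk
    { app := fun _ => ModuleCat.ofHom (F.mapLinearMap k)
      naturality := fun X Y f => by
        ext (g : X.unop ⟶ x)
        exact F.map_comp f.unop g }

instance : (restr k F).Additive where
  map_add := rfl

/-- `F^*(C(-, x)) ≅ D(-, F(x))`. -/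
def indYonedaIso (x : C) :
    (ind k F).obj ((yonedaMod k C).obj x) ≅ (yonedaMod k D).obj (F.obj x) where
  hom := ObjectProperty.homMk (indLift k F ((yonedaMod k D).obj (F.obj x)).property
    (yonedaModMap F x).hom)
  inv := yonedaHom k ((ind k F).obj ((yonedaMod k C).obj x)) (F.obj x)
    (indMk k F ((yonedaMod k C).obj x).obj x (F.obj x) (show x ⟶ x from 𝟙 x) (𝟙 _))
  hom_inv_id := by
    refine ObjectProperty.hom_ext _ (NatTrans.ext (funext fun Y => indObj_hom_ext k F ?_))
    intro z (m : z ⟶ x) g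
    refine (congrArg (fun h : Y.unop ⟶ F.obj x => ((indObj k F _).map h.op).hom (indMk k F
      ((yonedaMod k C).obj x).obj x (F.obj x) (show x ⟶ x from 𝟙 x) (𝟙 _)))
      (indLift_indMk k F ((yonedaMod k D).obj (F.obj x)).property
      (yonedaModMap F x).hom z Y.unop m g)).trans ?_
    refine (indObj_map_indMk k F ((yonedaMod k C).obj x).obj x (g ≫ F.map m)
      (show x ⟶ x from 𝟙 x) (𝟙 _)).trans ?_
    rw [Category.comp_id]
    refine (indMk_balanced k F ((yonedaMod k C).obj x).obj m Y.unop
      (show x ⟶ x from 𝟙 x) g).symm.trans ?_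
    exact congrArg (fun q => indMk k F ((yonedaMod k C).obj x).obj z Y.unop q g)
      (Category.comp_id m)
  inv_hom_id := by
    refine ObjectProperty.hom_ext _ (NatTrans.ext (funext fun Y => ?_))
    ext (g : Y.unop ⟶ F.obj x)
    refine (congrArg _ (indObj_map_indMk k F ((yonedaMod k C).obj x).obj x g
      (show x ⟶ x from 𝟙 x) (𝟙 _))).trans ?_
    refine (indLift_indMk k F ((yonedaMod k D).obj (F.obj x)).property
      (yonedaModMap F x).hom x Y.unop _ _).trans ?_
    change (g ≫ 𝟙 _) ≫ F.map (𝟙 x) = g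
    simp

/-- Pointwise exactness of a presentation is converted into a categorical cokernel, which left
adjoints preserve. -/
lemma exists_cokernel_iso_of_isFP {M : ModCat k C} (hM : isFP k C M) :
    ∃ (x y : C) (f : (yonedaMod k C).obj y ⟶ (yonedaMod k C).obj x),
      Nonempty (cokernel f ≅ M) := by
  obtain ⟨x, y, f, p, h⟩ := hM
  have w : f ≫ p = 0 := ObjectProperty.hom_ext _ (NatTrans.ext (funext fun c =>
    ModuleCat.hom_ext (LinearMap.ext fun z => ((h c).1 _).2 ⟨z, rfl⟩)))
  have hπ (c z) : ((cokernel.desc f p w).hom.app c).hom (((cokernel.π f).hom.app c).hom z) =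
      (p.hom.app c).hom z :=
    congrArg (fun q => (q.hom.app c).hom z) (cokernel.π_desc f p w)
  have hex : (ShortComplex.mk f (cokernel.π f) (cokernel.condition f)).Exact :=
    ShortComplex.exact_cokernel f
  have : IsIso (cokernel.desc f p w) := by
    refine ModCat.isIso_of_bijective_app _ fun c => ⟨?_, fun m => ?_⟩
    · rw [injective_iff_map_eq_zero]
      intro z hz
      obtain ⟨z, rfl⟩ := ModCat.surjective_app (cokernel.π f) c z
      rw [hπ] at hz
      exact (ModCat.exact_app hex c z).2 (((h c).1 z).1 hz)
    · obtain ⟨z, hz⟩ := (h c).2 m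
      exact ⟨((cokernel.π f).hom.app c).hom z, (hπ c z).trans hz⟩
  exact ⟨x, y, f, ⟨asIso (cokernel.desc f p w)⟩⟩

/-- `F^*` preserves finitely presented modules. -/
lemma isFP_ind [HasZeroObject D] [HasBinaryBiproducts D] {M : ModCat k C} (hM : isFP k C M) :
    isFP k D ((ind k F).obj M) := by
  obtain ⟨x, y, f, ⟨e⟩⟩ := exists_cokernel_iso_of_isFP hM
  have : PreservesColimits (ind k F) := (indAdj k F).leftAdjoint_preservesColimits
  have hY (z : C) : isFP k D ((ind k F).obj ((yonedaMod k C).obj z)) :=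
    -- `F^*` is right exact and sends representables to representables, so it carries a presentation
    -- to a presentation.
    (isFP k D).prop_of_iso (indYonedaIso F z).symm (isFP_yonedaMod _)
  have := (indAdj k F).left_adjoint_additive
  exact (isFP k D).prop_of_iso ((PreservesCokernel.iso (ind k F) f).symm ≪≫ (ind k F).mapIso e)
    ((isFP k D).prop_cokernel _ (hY _) (hY _))

lemma restr_faithful [F.EssSurj] : (restr k F).Faithful where
  map_injective {M N} α β h := by
    refine ObjectProperty.hom_ext _ (NatTrans.ext (funext fun c => ?_))
    rw [← cancel_epi (M.obj.map (F.objObjPreimageIso c.unop).inv.op), α.hom.naturality,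
      β.hom.naturality]
    exact congrArg (fun q => q.hom.app (op (F.objPreimage c.unop)) ≫
      N.obj.map (F.objObjPreimageIso c.unop).inv.op) h

lemma restr_full [F.EssSurj] [F.Full] : (restr k F).Full where
  map_surjective {M N} γ := by
    obtain ⟨α, hα⟩ := whiskerLeft_surjective F.op M.obj N.obj γ.hom
    exact ⟨ObjectProperty.homMk α, ObjectProperty.hom_ext _ hα⟩

variable {F}

/-- When `F` is full and its kernel kills `M`, a morphism `F a ⟶ F x` acts on `M` through any of its
lifts. The inverse of the unit at `a` sends `m ⊗ g` to the action on `m` of a lift of `g`. -/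
lemma isIso_indAdj_unit_app [F.Full] {M : ModCat k C} (hM : AnnihilatedByKer F M) :
    IsIso ((indAdj k F).unit.app M) := by
  refine ModCat.isIso_of_bijective_app _ fun a => ?_
  -- The action of the chosen lift may be computed with any other lift. Bilinearity and balancedness
  -- follow, since sums, multiples and composites of lifts are lifts.
  have hpre {x y : C} (g : F.obj x ⟶ F.obj y) (f : x ⟶ y) (h : F.map f = g)
      (m : M.obj.obj (op y)) :
      (M.obj.map (F.preimage g).op).hom m = (M.obj.map f.op).hom m :=
    congrArg (fun q => q.hom m) (hM.map_eq ((F.map_preimage g).trans h.symm))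
  let φ (x : C) : M.obj.obj (op x) →ₗ[k] (F.obj a.unop ⟶ F.obj x) →ₗ[k] M.obj.obj a :=
    LinearMap.mk₂ k (fun m g => (M.obj.map (F.preimage g).op).hom m)
      (fun m m' g => map_add _ _ _) (fun r m g => map_smul _ _ _)
      (fun m g g' => by
        rw [hpre (g + g') (F.preimage g + F.preimage g') (by simp)]
        exact ModCat.map_add_apply M _ _ m)
      (fun r m g => by
        rw [hpre (r • g) (r • F.preimage g) (by simp)]
        exact ModCat.map_smul_apply M _ _ m)
  let Ψ : (indObj k F M.obj).obj (op (F.obj a.unop)) →ₗ[k] M.obj.obj a :=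
    tensorLift (M := M.obj) (N := F ⋙ (linearCoyoneda k D).obj (op (F.obj a.unop))) φ
      fun x y f m (g : F.obj a.unop ⟶ F.obj x) => by
        refine (ModCat.map_comp_apply M (F.preimage g) f m).symm.trans ?_
        exact (hpre (g ≫ F.map f) (F.preimage g ≫ f) (by simp) m).symm
  have hΨ (x m g) : Ψ (indMk k F M.obj x (F.obj a.unop) m g) =
      (M.obj.map (F.preimage g).op).hom m :=
    tensorLift_tmulOver (M := M.obj) (N := F ⋙ (linearCoyoneda k D).obj (op (F.obj a.unop)))
      φ _ x m g
  let η : M.obj.obj a →ₗ[k] (indObj k F M.obj).obj (op (F.obj a.unop)) :=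
    (((indAdj k F).unit.app M).hom.app a).hom
  have hη (m) : η m = indMk k F M.obj a.unop (F.obj a.unop) m (𝟙 _) := rfl
  refine Function.bijective_iff_has_inverse.2 ⟨Ψ, fun m => ?_, fun z => ?_⟩
  · change Ψ (η m) = m
    rw [hη, hΨ, hpre _ (𝟙 _) (by simp)]
    exact congrArg (fun q => q.hom m) (M.obj.map_id a)
  · have : ModuleCat.ofHom (η ∘ₗ Ψ) = 𝟙 _ := indObj_hom_ext k F fun x m g => by
      change η (Ψ _) = _
      rw [hΨ, hη]
      -- Moving the lift of `g` across the tensor sign turns `(m · f) ⊗ 1` into `m ⊗ g`.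
      refine (indMk_balanced k F M.obj (F.preimage g) (F.obj a.unop) m (𝟙 _)).trans ?_
      rw [Category.id_comp, F.map_preimage]
      rfl
    exact congrArg (fun q => q.hom z) this

variable (h : IsCoherentPreserving k F)

lemma fpRestr_faithful [F.EssSurj] : (fpRestr k h).Faithful := by
  have := restr_faithful (k := k) F
  exact Functor.Faithful.of_comp_iso (H := (isFP k D).ι ⋙ restr k F) (G := (isFP k C).ι)
    (Iso.refl _)

lemma fpRestr_full [F.EssSurj] [F.Full] : (fpRestr k h).Full := by
  have := restr_full (k := k) F
  exact Functor.Full.of_comp_faithful_iso (H := (isFP k D).ι ⋙ restr k F) (G := (isFP k C).ι)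
    (Iso.refl _)

instance : (fpRestr k h).Additive where
  map_add := rfl

instance : (fpRestr k h).Linear k where
  map_smul _ _ := rfl

/-- The preimage is `F^*(M)`, and the unit provides the isomorphism. -/
lemma fpRestr_essImage [F.Full] (hInd : ∀ M : FPModCat k C, isFP k D ((ind k F).obj M.obj)) {M : FPModCat k C} (hM : AnnihilatedByKer F M.obj) :
    (fpRestr k h).essImage M := by
  have := isIso_indAdj_unit_app hM
  exact ⟨⟨_, hInd M⟩, ⟨(isFP k C).isoMk (asIso ((indAdj k F).unit.app M.obj)).symm⟩⟩

end Induced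

/-! ### `Ext` under a fully faithful exact functor: dimension shifting. -/

section Ext

open Abelian

variable {A : Type w} [Category.{v} A] [Abelian A] {B : Type w'} [Category.{v'} B] [Abelian B]
  (F : A ⥤ B) [F.Additive] [PreservesFiniteLimits F] [PreservesFiniteColimits F]
  [F.Full] [F.Faithful] [HasExt.{max w v} A] [HasExt.{max w' v'} B]

attribute [local simp] Ext.mapExactFunctor_comp Ext.mapExactFunctor_mk₀ Ext.mapExactFunctor_extClass

lemma mapExt_bijective_zero (X Y : A) : Function.Bijective (F.mapExtAddHom X Y 0) := by
  simpa [Ext.mapExactFunctor₀] using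
    ⟨Functor.Faithful.map_injective, Functor.Full.map_surjective⟩

attribute [local instance] Ext.subsingleton_of_projective in
/-- Dimension shifting in the first variable. -/
lemma mapExt_bijective_succ_of_projective {S : ShortComplex A} (hS : S.ShortExact)
    (hP : Projective (F.obj S.X₂)) (Y : A) (n : ℕ)
    (hn : Function.Bijective (F.mapExtAddHom S.X₁ Y n)) :
    Function.Bijective (F.mapExtAddHom S.X₃ Y (n + 1)) := by
  -- Projectivity is assumed only after applying `F` and descends to `A`; both long exact sequences
  -- then have a vanishing term at `X₂` in degree `n + 1`, and the right-exact four-term comparison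
  -- applies.
  have : Projective S.X₂ := F.projective_of_map_projective hP
  have : Projective (S.map F).X₂ := hP
  -- Surjectivity at the middle object is enough: fullness gives it in degree zero, and in positive
  -- degrees the target vanishes.
  have h₂ : Function.Surjective (F.mapExtAddHom S.X₂ Y n) := by
    cases n with
    | zero => exact (mapExt_bijective_zero F _ _).2
    | succ n => exact fun y => ⟨0, (Ext.subsingleton_of_projective _ _ _).elim _ _⟩
  exact AddMonoidHom.bijective_of_surjective_of_bijective_of_right_exact _ _ _ _
    (F.mapExtAddHom S.X₂ Y n) (F.mapExtAddHom S.X₁ Y n) (F.mapExtAddHom S.X₃ Y (n + 1))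
    (by cat_disch) (by cat_disch)
    ((ShortComplex.ab_exact_iff_function_exact _).1
      (Ext.contravariant_sequence_exact₁' hS Y n (n + 1) (add_comm 1 n)))
    ((ShortComplex.ab_exact_iff_function_exact _).1
      (Ext.contravariant_sequence_exact₁' (hS.map_of_exact F) (F.obj Y) n (n + 1) (add_comm 1 n)))
    h₂ hn
    (fun x₃ ↦ Ext.contravariant_sequence_exact₃ hS _ x₃ (by subsingleton) (add_comm 1 n))
    (fun y₃ ↦ Ext.contravariant_sequence_exact₃ (hS.map_of_exact F) _ y₃ (by subsingleton) (add_comm 1 n))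

attribute [local instance] Ext.subsingleton_of_injective in
/-- Dimension shifting in the second variable. -/
lemma mapExt_bijective_succ_of_injective {S : ShortComplex A} (hS : S.ShortExact)
    (hI : Injective (F.obj S.X₂)) (X : A) (n : ℕ)
    (hn : Function.Bijective (F.mapExtAddHom X S.X₃ n)) :
    Function.Bijective (F.mapExtAddHom X S.X₁ (n + 1)) := by
  have : Injective S.X₂ := F.injective_of_map_injective hI
  have : Injective (S.map F).X₂ := hI
  have h₂ : Function.Surjective (F.mapExtAddHom X S.X₂ n) := by
    cases n with
    | zero => exact (mapExt_bijective_zero F _ _).2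
    | succ n => exact fun y => ⟨0, (Ext.subsingleton_of_injective _ _ _).elim _ _⟩
  exact AddMonoidHom.bijective_of_surjective_of_bijective_of_right_exact _ _ _ _
    (F.mapExtAddHom X S.X₂ n) (F.mapExtAddHom X S.X₃ n) (F.mapExtAddHom X S.X₁ (n + 1))
    (by cat_disch) (by cat_disch)
    ((ShortComplex.ab_exact_iff_function_exact _).mp
      (Ext.covariant_sequence_exact₃' X hS n (n + 1) rfl))
    ((ShortComplex.ab_exact_iff_function_exact _).mp
      (Ext.covariant_sequence_exact₃' (F.obj X) (hS.map_of_exact F) n (n + 1) rfl))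
    h₂ hn
    (fun x₁ ↦ Ext.covariant_sequence_exact₁ _ hS x₁ (by subsingleton) rfl)
    (fun y₁ ↦ Ext.covariant_sequence_exact₁ _ (hS.map_of_exact F) y₁ (by subsingleton) rfl)

end Ext

/-! ### Eventual comparison of `Ext` along a direct system. -/

section ExtSystem

open Abelian

variable {I : Type u} [Preorder I] [IsDirectedOrder I] {A : I → Type w} [∀ i, Category.{v} (A i)]
  [∀ i, Abelian (A i)] {B : Type w'} [Category.{v'} B] [Abelian B]
  (Ψ : ∀ i, A i ⥤ B) [∀ i, (Ψ i).Additive] [∀ i, PreservesFiniteLimits (Ψ i)]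
  [∀ i, PreservesFiniteColimits (Ψ i)] [∀ i, (Ψ i).Full] [∀ i, (Ψ i).Faithful]
  [∀ i, HasExt.{max w v} (A i)] [HasExt.{max w' v'} B]

/-- If `B` has enough projectives and every object of `B` is eventually in the essential image of
`Ψ u`, then `Ψ u` is eventually bijective on `Ext` out of the preimages of an object of `B`. -/
lemma exists_mapExt_bijective_left [EnoughProjectives B]
    (hΨ : ∀ x : B, ∃ t, ∀ u, t < u → (Ψ u).essImage x) (n : ℕ) (x : B) :
    ∃ t, ∀ u, t < u → ∀ (a : A u), Nonempty ((Ψ u).obj a ≅ x) → ∀ (z : A u) (r : ℕ), r ≤ n →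
      Function.Bijective ((Ψ u).mapExtAddHom a z r) := by
  induction n generalizing x with
  | zero =>
    obtain ⟨t, ht⟩ := hΨ x
    refine ⟨t, fun u hu a _ z r hr => ?_⟩
    obtain rfl : r = 0 := by lia
    exact mapExt_bijective_zero _ _ _
  | succ n ih =>
    -- The presentation is chosen in `B` before `u`, so the threshold depends only on `x` and `n`,
    -- not on `z`.
    let P : ProjectivePresentation x := Classical.arbitrary _
    obtain ⟨t₁, h₁⟩ := hΨ P.p
    obtain ⟨t₂, h₂⟩ := ih (kernel P.f)
    obtain ⟨t, ht₁, ht₂⟩ := exists_ge_ge t₁ t₂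
    refine ⟨t, fun u hu a ⟨e⟩ z r hr => ?_⟩
    obtain ⟨p, ⟨e'⟩⟩ := h₁ u (ht₁.trans_lt hu)
    -- Fullness lifts the presentation to `A u`, and faithfulness makes the lift an epimorphism.
    obtain ⟨f, hf⟩ := (Ψ u).map_surjective (e'.hom ≫ P.f ≫ e.inv)
    have hef : (Ψ u).map f ≫ e.hom = e'.hom ≫ P.f := by simp [hf]
    have : Epi f := (Ψ u).epi_of_epi_map (by rw [hf]; infer_instance)
    let S := ShortComplex.mk _ _ (kernel.condition f)
    have hS : S.ShortExact := { exact := ShortComplex.exact_kernel f }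
    have hK (z : A u) (r : ℕ) (hr : r ≤ n) :
        Function.Bijective ((Ψ u).mapExtAddHom (kernel f) z r) :=
      -- By exactness `Ψ u` sends the kernel of the lift to the kernel of `P.f`. The induction
      -- hypothesis covers it because it is stated for all preimages of an object up to isomorphism.
      h₂ u (ht₂.trans_lt hu) _
        ⟨PreservesKernel.iso (Ψ u) f ≪≫ kernel.mapIso _ _ e' e hef⟩ z r hr
    cases r with
    | zero => exact mapExt_bijective_zero _ _ _
    | succ r =>
      exact mapExt_bijective_succ_of_projective (Ψ u) hS (P.projective.of_iso e'.symm) z r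
        (hK z r (by lia))

/-- If `B` has enough injectives and every object of `B` is eventually in the essential image of
`Ψ u`, then `Ψ u` is eventually bijective on `Ext` into the preimages of an object of `B`. -/
lemma exists_mapExt_bijective_right [EnoughInjectives B]
    (hΨ : ∀ x : B, ∃ t, ∀ u, t < u → (Ψ u).essImage x) (n : ℕ) (y : B) :
    ∃ t, ∀ u, t < u → ∀ (a : A u), Nonempty ((Ψ u).obj a ≅ y) → ∀ (z : A u) (r : ℕ), r ≤ n →
      Function.Bijective ((Ψ u).mapExtAddHom z a r) := by
  induction n generalizing y with
  | zero =>
    obtain ⟨t, ht⟩ := hΨ y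
    refine ⟨t, fun u hu a _ z r hr => ?_⟩
    obtain rfl : r = 0 := by lia
    exact mapExt_bijective_zero _ _ _
  | succ n ih =>
    let J : InjectivePresentation y := Classical.arbitrary _
    obtain ⟨t₁, h₁⟩ := hΨ J.J
    obtain ⟨t₂, h₂⟩ := ih (cokernel J.f)
    obtain ⟨t, ht₁, ht₂⟩ := exists_ge_ge t₁ t₂
    refine ⟨t, fun u hu a ⟨e⟩ z r hr => ?_⟩
    obtain ⟨q, ⟨e'⟩⟩ := h₁ u (ht₁.trans_lt hu)
    -- Dually, an injective presentation is lifted and its cokernel is handled by induction.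
    obtain ⟨f, hf⟩ := (Ψ u).map_surjective (e.hom ≫ J.f ≫ e'.inv)
    have hef : (Ψ u).map f ≫ e'.hom = e.hom ≫ J.f := by simp [hf]
    have : Mono f := (Ψ u).mono_of_mono_map (by rw [hf]; infer_instance)
    let S := ShortComplex.mk _ _ (cokernel.condition f)
    have hS : S.ShortExact := { exact := ShortComplex.exact_cokernel f }
    have hK (z : A u) (r : ℕ) (hr : r ≤ n) :
        Function.Bijective ((Ψ u).mapExtAddHom z (cokernel f) r) :=
      h₂ u (ht₂.trans_lt hu) _
        ⟨PreservesCokernel.iso (Ψ u) f ≪≫ cokernel.mapIso _ _ e e' hef⟩ z r hr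
    cases r with
    | zero => exact mapExt_bijective_zero _ _ _
    | succ r =>
      exact mapExt_bijective_succ_of_injective (Ψ u) hS (Injective.of_iso e'.symm J.injective) z r
        (hK z r (by lia))

variable (R : Type uR) [Ring R] {A' : Type w} [Category.{v} A'] [Abelian A'] [Linear R A']
  [HasExt.{max w v} A']

/-- Isomorphisms induce linear equivalences of `Ext`-modules. -/
def extLinearEquivOfIso {X X' Y Y' : A'} (e : X' ≅ X) (e' : Y ≅ Y') (n : ℕ) :
    Ext.{max w v} X Y n ≃ₗ[R] Ext.{max w v} X' Y' n where
  toFun x := ((Ext.mk₀ e.hom).comp x (zero_add n)).comp (Ext.mk₀ e'.hom) (add_zero n)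
  invFun x := ((Ext.mk₀ e.inv).comp x (zero_add n)).comp (Ext.mk₀ e'.inv) (add_zero n)
  map_add' x y := by simp
  map_smul' r x := by simp
  left_inv x := by simp
  right_inv x := by simp

end ExtSystem

/-! ### A criterion for admissibility. -/

section Admissible

open Abelian

/-- A target of a direct system of abelian categories and fully faithful exact functors is
admissible if it is abelian with enough projectives and injectives, its functors are fully faithful
with adjoints on both sides, and each of its objects is eventually in their essential images. -/
theorem isAdmissibleTarget_of_essImage (R : Type uR) [Ring R] {I : Type u} [Preorder I]
    [IsDirectedOrder I] {A : I → Type w} [∀ i, Category.{v} (A i)] [∀ i, Preadditive (A i)]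
    [∀ i, Linear R (A i)] {S : DirectSystem I A} {B : Type w'} [Category.{v'} B] [Preadditive B]
    [Linear R B] (T : S.Target B) {L K : ∀ i, B ⥤ A i} (adjL : ∀ i, L i ⊣ T.Ψ i)
    (adjK : ∀ i, T.Ψ i ⊣ K i) (hA : ∀ i, IsAbelianCat (A i)) (hB : IsAbelianCat B)
    (full_G : ∀ {i j : I} (h : i < j), (S.G h).Full)
    (faithful_G : ∀ {i j : I} (h : i < j), (S.G h).Faithful)
    (preservesFiniteLimits_G : ∀ {i j : I} (h : i < j), PreservesFiniteLimits (S.G h))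
    (preservesFiniteColimits_G : ∀ {i j : I} (h : i < j), PreservesFiniteColimits (S.G h))
    [∀ i, (T.Ψ i).Additive] [∀ i, (T.Ψ i).Linear R] [∀ i, (T.Ψ i).Full] [∀ i, (T.Ψ i).Faithful]
    [EnoughProjectives B] [EnoughInjectives B]
    (hΨ : ∀ x : B, ∃ t, ∀ u, t < u → (T.Ψ u).essImage x) :
    IsAdmissibleTarget R T adjL adjK := by
  let := fun i => (hA i).toAbelian
  let := hB.toAbelian
  have := fun i => HasExt.standard (A i)
  have := HasExt.standard B
  have (i : I) : PreservesFiniteLimits (T.Ψ i) :=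
    have := (adjL i).rightAdjoint_preservesLimits
    inferInstance
  have (i : I) : PreservesFiniteColimits (T.Ψ i) :=
    have := (adjK i).leftAdjoint_preservesColimits
    inferInstance
  have hiso (x : B) : ∃ t, ∀ u, t < u →
      IsIso ((adjL u).unit.app x) ∧ IsIso ((adjK u).counit.app x) := by
    obtain ⟨t, ht⟩ := hΨ x
    -- As `Ψ u` is fully faithful, it is both a reflective and a coreflective embedding; unit and
    -- counit are invertible precisely on the essential image.
    exact ⟨t, fun u hu => ⟨(adjL u).isIso_unit_app_iff_mem_essImage.2 (ht u hu),
      (adjK u).isIso_counit_app_iff_mem_essImage.2 (ht u hu)⟩⟩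
  refine ⟨hA, full_G, faithful_G, preservesFiniteLimits_G, preservesFiniteColimits_G, hB,
    inferInstance, inferInstance, hiso, fun x n _ => ?_, fun y n _ => ?_⟩
  · obtain ⟨t₁, h₁⟩ := hiso x
    obtain ⟨t₂, h₂⟩ := exists_mapExt_bijective_left T.Ψ hΨ n x
    obtain ⟨t, ht₁, ht₂⟩ := exists_ge_ge t₁ t₂
    refine ⟨t, fun u hu z r _ hr => ?_⟩
    have := (h₁ u (ht₁.trans_lt hu)).1
    let e : x ≅ (T.Ψ u).obj ((L u).obj x) := asIso ((adjL u).unit.app x)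
    -- The unit exhibits `L u x` as a preimage of `x`, so the comparison applies to it.
    have hb : Function.Bijective ((T.Ψ u).mapExtLinearMap R ((L u).obj x) z r) :=
      h₂ u (ht₂.trans_lt hu) _ ⟨e.symm⟩ z r hr.le
    exact ⟨(extLinearEquivOfIso R e.symm (Iso.refl _) r).trans
      (LinearEquiv.ofBijective _ hb).symm⟩
  · obtain ⟨t₁, h₁⟩ := hiso y
    obtain ⟨t₂, h₂⟩ := exists_mapExt_bijective_right T.Ψ hΨ n y
    obtain ⟨t, ht₁, ht₂⟩ := exists_ge_ge t₁ t₂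
    refine ⟨t, fun u hu z r _ hr => ?_⟩
    have := (h₁ u (ht₁.trans_lt hu)).2
    let e : (T.Ψ u).obj ((K u).obj y) ≅ y := asIso ((adjK u).counit.app y)
    have hb : Function.Bijective ((T.Ψ u).mapExtLinearMap R z ((K u).obj y) r) :=
      h₂ u (ht₂.trans_lt hu) _ ⟨e⟩ z r hr.le
    exact ⟨(extLinearEquivOfIso R (Iso.refl _) e.symm r).trans
      (LinearEquiv.ofBijective _ hb).symm⟩

end Admissible

/-! ### Density and fullness of the second factor of a composite. -/

section Composition

variable {C D E : Type*} [Category* C] [Category* D] [Category* E] {F : C ⥤ D} {G : D ⥤ E}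
  {H : C ⥤ E}

lemma essSurj_of_comp_iso (e : F ⋙ G ≅ H) [H.EssSurj] : G.EssSurj where
  mem_essImage y := ⟨F.obj (H.objPreimage y), ⟨e.app _ ≪≫ H.objObjPreimageIso y⟩⟩

/-- Density of `F` allows both endpoints to be replaced by objects `F x`, where fullness of the
composite lifts the morphism. With `Φ_j ⋙ F_ij ≅ Φ_i` this makes the transition functors full. -/
lemma full_of_comp_iso (e : F ⋙ G ≅ H) [F.EssSurj] [H.Full] : G.Full where
  map_surjective {c d} g := by
    have : (F ⋙ G).Full := Functor.Full.of_iso e.symm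
    obtain ⟨f, hf⟩ := (F ⋙ G).map_surjective (G.map (F.objObjPreimageIso c).hom ≫ g ≫
      G.map (F.objObjPreimageIso d).inv)
    refine ⟨(F.objObjPreimageIso c).inv ≫ F.map f ≫ (F.objObjPreimageIso d).hom, ?_⟩
    rw [Functor.comp_map] at hf
    rw [Functor.map_comp, Functor.map_comp, hf]
    simp

end Composition

/-! ### Firm objects and the modules they generate. -/

section Firm

variable {I : Type u} [Preorder I] {C : I → Type w} [∀ i, Category.{v} (C i)] {S : InverseSystem I C}

/-- The structure maps of `a` are invertible, so a component of a morphism determines all components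
at smaller indices. -/
lemma InverseSystem.Limit.app_eq_of_lt {a x : S.Limit} {s s' : a ⟶ x} {i j : I} (h : i < j)
    (hj : s.app j = s'.app j) : s.app i = s'.app i := by
  rw [← cancel_epi (a.iso h).hom, s.comm h, s'.comm h, hj]

/-- If `I` has no maximal elements, then `Φ_u` is eventually faithful on maps into a firm object. -/
lemma InverseSystem.exists_hom_ext_of_isFirm [IsDirectedOrder I] (hI : ∀ i : I, ∃ j, i < j) {x : S.Limit}
    (hx : S.isFirm x) : ∃ t, ∀ u, t < u → ∀ (a : S.Limit) (s s' : a ⟶ x),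
      s.app u = s'.app u → s = s' := by
  obtain ⟨t, ht⟩ := hx
  refine ⟨t, fun u hu a s s' h => Limit.Hom.ext (funext fun i => ?_)⟩
  obtain ⟨v, hiv, htv⟩ := exists_ge_ge i t
  -- The absence of maximal elements provides an index strictly above both `i` and `t`, since
  -- firmness and the transition functors concern strict inequalities only.
  obtain ⟨w, hvw⟩ := hI v
  refine Limit.app_eq_of_lt (hiv.trans_lt hvw) ?_
  have htw := htv.trans_lt hvw
  refine ((ht w htw).2 _).1 ?_
  change (S.F htw).map (s.app w) = (S.F htw).map (s'.app w)
  -- Agreement at `u` descends to `t`, and firmness of `x` lifts it from `t` up to `w`.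
  rw [← cancel_mono (x.iso htw).hom, ← s.comm htw, ← s'.comm htw, Limit.app_eq_of_lt hu h]

end Firm

section FirmModules

variable {k : Type u} [Field k] {I : Type u} [Preorder I] [IsDirectedOrder I]
  {C : I → Type u} [∀ i, Category.{u} (C i)] [∀ i, Preadditive (C i)] [∀ i, Linear k (C i)]
  {S : InverseSystem I C}
  [∀ (i j : I) (h : i < j), (S.F h).Additive] [∀ (i j : I) (h : i < j), (S.F h).Linear k]

/-- If `I` has no maximal elements, then a finitely presented module over the firm source is
eventually annihilated by the kernel of `Φ_u`. -/
lemma exists_annihilatedByKer (hI : ∀ i : I, ∃ j, i < j) (M : FPModCat k S.Firm) :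
    ∃ t, ∀ u, t < u → AnnihilatedByKer (S.firmSource.Φ u) M.obj := by
  obtain ⟨x, -, -, m, hm, -⟩ := (isFP_iff _).1 M.property
  obtain ⟨t, ht⟩ := InverseSystem.exists_hom_ext_of_isFirm hI x.property
  refine ⟨t, fun u hu a b f hf => ModuleCat.hom_ext (LinearMap.ext fun n => ?_)⟩
  obtain ⟨h, rfl⟩ := hm _ n
  -- Any element is the generator acted on by some `h` into the firm object `x`, so it suffices that
  -- `f ≫ h` vanishes, and vanishing of maps into `x` is detected at `u`.
  have hfh : f ≫ h = 0 := ObjectProperty.hom_ext _ (ht u hu _ _ _ (by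
    change (S.firmSource.Φ u).map (f ≫ h) = (S.firmSource.Φ u).map 0
    rw [Functor.map_comp, hf, zero_comp, Functor.map_zero]))
  rw [← ModCat.map_comp_apply, hfh]
  have := M.obj.property.1
  exact (congrArg (fun q : M.obj.obj.obj (op x) ⟶ M.obj.obj.obj (op a) => q.hom m)
    (M.obj.obj.map_zero _ _)).trans rfl

end FirmModules

end

end AdmTarget

/-! ### The theorem. -/

theorem mainTheorem5 {k : Type u} [Field k] {I : Type u} [Preorder I] [IsDirectedOrder I]
    {C : I → Type u} [∀ i, Category.{u} (C i)] [∀ i, Preadditive (C i)] [∀ i, Linear k (C i)]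
    (S : AdmTarget.InverseSystem I C)
    [∀ (i j : I) (h : i < j), (S.F h).Additive] [∀ (i j : I) (h : i < j), (S.F h).Linear k]
    (hC : ∀ i, AdmTarget.IsDualizingVariety k (C i))
    (hF : ∀ (i j : I) (h : i < j), AdmTarget.IsCoherentPreserving k (S.F h))
    (hFirm : AdmTarget.IsDualizingVariety k S.Firm)
    (hDense : ∀ i, (S.firmSource.Φ i).EssSurj)
    (hFull : ∀ i, (S.firmSource.Φ i).Full)
    (hΦ : ∀ i, AdmTarget.IsCoherentPreserving k (S.firmSource.Φ i)) :
    ∃ hInd : ∀ (i : I) (M : AdmTarget.FPModCat k S.Firm),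
        AdmTarget.isFP k (C i) ((AdmTarget.ind k (S.firmSource.Φ i)).obj M.obj),
      AdmTarget.IsAdmissibleTarget k (AdmTarget.modTarget k hF S.firmSource hΦ)
        (fun i => AdmTarget.fpIndAdj k (hInd i) (hΦ i))
        (fun i => AdmTarget.fpCoindAdj k (hΦ i)) := by
  open AdmTarget in
  have (i : I) : HasFiniteBiproducts (C i) := (hC i).krullSchmidt.hasFiniteBiproducts
  have (i : I) : HasBinaryBiproducts (C i) := hasBinaryBiproducts_of_finite_biproducts _
  have (i : I) : HasZeroObject (C i) := hasZeroObject_of_hasFiniteBiproducts _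
  have hInd (i : I) (M : FPModCat k S.Firm) :
      isFP k (C i) ((ind k (S.firmSource.Φ i)).obj M.obj) := isFP_ind _ M.property
  have hF_ess {i j : I} (h : i < j) : (S.F h).EssSurj := essSurj_of_comp_iso (S.firmSource.Θ h)
  have hF_full {i j : I} (h : i < j) : (S.F h).Full := full_of_comp_iso (S.firmSource.Θ h)
  have hF_ind {i j : I} (h : i < j) (M : FPModCat k (C j)) :
      isFP k (C i) ((ind k (S.F h)).obj M.obj) := isFP_ind _ M.property
  have (i : I) : ((modTarget k hF S.firmSource hΦ).Ψ i).Additive :=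
    inferInstanceAs (fpRestr k (hΦ i)).Additive
  have (i : I) : ((modTarget k hF S.firmSource hΦ).Ψ i).Linear k :=
    inferInstanceAs ((fpRestr k (hΦ i)).Linear k)
  have (i : I) : ((modTarget k hF S.firmSource hΦ).Ψ i).Full := fpRestr_full (hΦ i)
  have (i : I) : ((modTarget k hF S.firmSource hΦ).Ψ i).Faithful := fpRestr_faithful (hΦ i)
  have := hFirm.enoughProjectives
  have := hFirm.enoughInjectives
  refine ⟨hInd, isAdmissibleTarget_of_essImage k _ _ _ (fun i => (hC i).isAbelianCat)
    hFirm.isAbelianCat (fun h => fpRestr_full (hF _ _ h)) (fun h => fpRestr_faithful (hF _ _ h))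
    (fun h => ?_) (fun h => ?_) fun M => ?_⟩
  -- Exactness of `F_ij*` comes from its two adjoints, `F_ij^*` for limits and `F_ij^!` for
  -- colimits.
  · have := (fpIndAdj k (hF_ind h) (hF _ _ h)).rightAdjoint_preservesLimits
    exact PreservesLimits.preservesFiniteLimits (fpRestr k (hF _ _ h))
  · have := (fpCoindAdj k (hF _ _ h)).leftAdjoint_preservesColimits
    exact PreservesColimits.preservesFiniteColimits (fpRestr k (hF _ _ h))
  · by_cases hI : ∀ i : I, ∃ j, i < j
    · obtain ⟨t, ht⟩ := exists_annihilatedByKer hI M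
      exact ⟨t, fun u hu => fpRestr_essImage (hΦ u) (hInd u) (ht u hu)⟩
    -- Some `t` has nothing strictly above it, so the condition at `t` is vacuous.
    · push Not at hI
      obtain ⟨t, ht⟩ := hI
      exact ⟨t, fun u hu => (ht u hu).elim⟩
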